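/- Let $V$ be a $3$-dimensional complex vector space with basis $e_1,e_2,e_3$, and let $d\ge 2$ and $0\le j\le d$ be integers. Identify $S_{(d,d)}V$ with $S^d(\wedge^2V)$. **Brill's map.** Let $\pi_{d,d}:S^dV\otimes S^dV\to S^d(\wedge^2V)$ be the linear map with $(l_1\cdots l_d)\otimes(m_1\cdots m_d)\mapsto\sum_{\sigma\in\mathfrak S_d}\prod_{i}(l_i\wedge m_{\sigma(i)})$. For $f\in S^dV$ let $f_{k,d-k}\in S^kV\otimes S^{d-k}V$ be its $k$-th polarization, normalized so that $(l_1\cdots l_d)_{k,d-k}=\sum_{|I|=k}\prod_{i\in I}l_i\otimes\prod_{i\notin I}l_i$, let $E_k(f)=f_{k,d-k}\cdot(1\otimes f^{k-1})$ and $$Q_d(f)=\sum_{i_1+2i_2+\cdots+di_d=d}d\,(-1)^{d+i_1+\cdots+i_d}\,\frac{(i_1+\cdots+i_d-1)!}{i_1!\cdots i_d!}\,E_1(f)^{i_1}\cdots E_d(f)^{i_d}\in S^dV\otimes S^{d^2-d}V .$$ Brill's polynomial map is $\mathfrak B(f)=(\pi_{d,d}\otimes \mathrm{Id})(f\otimes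 Q_d(f))$, and Brill's map $\bar{\mathfrak B}:S^{d+1}(S^dV)\to S^d(\wedge^2V)\otimes S^{d^2-d}V$ is its complete polarization, the linear map with $$\bar{\mathfrak B}(w_1\cdots w_{d+1})=\frac1{(d+1)!}\sum_{\emptyset\ne I\subseteq\{1,\dots,d+1\}}(-1)^{d+1-|I|}\,\mathfrak B\Big(\sum_{i\in I}w_i\Big).$$ **Inner product.** Give $V^{\otimes(d^2+d)}$ the Hermitian inner product for which the tensors $e_{i_1}\otimes\cdots\otimes e_{i_{d^2+d}}$ are orthonormal, and regard $S^d(\wedge^2V)\otimes S^{d^2-d}V$ as a subspace of it through $u\wedge v=\frac12(u\otimes v-v\otimes u)$ and $u_1\cdots u_n=\frac1{n!}\sum_{\sigma\in\mathfrak S_n}u_{\sigma(1)}\otimes\cdots\otimes u_{\sigma(n)}$. **Vectors.** Let $v_j=(e_1^{d-1}e_2)^d\cdot(e_1^{d-j}e_3^j)\in S^{d+1}(S^dV)$ and $$\tilde v_j=\sum_{s=0}^{j}\sum_{t=0}^{s}(-1)^t\binom js\binom st(e_1\wedge e_2)^{d+s-j-t}(e_1\wedge e_3)^t(e_2\wedge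 e_3)^{j-s}\otimes e_1^{d^2-d-s}e_2^te_3^{s-t}.$$ **Statement.** The vector $\tilde v_j$ is a highest weight vector of weight $(d^2-j,d,j)$ in $S^d(\wedge^2V)\otimes S^{d^2-d}V$ (a nonzero weight vector killed by all raising operators $E^i_k$, $i<k$, where $E^i_k e_k=e_i$ and $E^i_ke_l=0$ for $l\neq k$); moreover $$\langle\bar{\mathfrak B}(v_j),\tilde v_j\rangle=\frac{(1/2)^d}{(d+1)(d^2-d)!}\Bigg(\sum_{t=0}^{j}\frac{(j!)^2(j-1)(d-t)!(d^2-d-j)!}{(j-t)!}+\sum_{t=0}^{j-1}\frac{(j!)^2(d-t-1)!(d^2-d-j+1)!}{(j-t-1)!}+(-1)^j(d-j)!\,j!\,(d^2-d)!\Bigg),$$ and $\langle\bar{\mathfrak B}(v_j),\tilde v_j\rangle=0$ if and only if $j=0$, or $j=1$, or $j=d=3$. -/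

import Mathlib

open scoped TensorProduct Nat

noncomputable section

namespace BrillMap

/-! ### Polynomial maps given on products of basis vectors, and polarization -/

/-- The linear map on `S^d W`, where `W` has basis `X i` (`i : ι`), that sends the product
`X (w 0) ⋯ X (w (d-1))` to `F w`, for a function `F` that does not depend on the order of the
factors (see `ofWords_prod`). Monomials of degree other than `d` are sent to `0`. -/
def ofWords {ι M : Type*} [AddCommGroup M] [Module ℂ M] (d : ℕ) (F : (Fin d → ι) → M) :
    MvPolynomial ι ℂ →ₗ[ℂ] M :=
  open Classical in
  (MvPolynomial.basisMonomials ι ℂ).constr ℂ fun a : ι →₀ ℕ =>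
    if h : ∃ w : Fin d → ι, ∑ i, Finsupp.single (w i) 1 = a then F h.choose else 0

/-- `ofWords d F` has the value `F w` on the product of the basis vectors listed in `w`. -/
theorem ofWords_prod {ι M : Type*} [AddCommGroup M] [Module ℂ M] (d : ℕ) (F : (Fin d → ι) → M)
    (hF : ∀ (w : Fin d → ι) (σ : Equiv.Perm (Fin d)), F (fun i => w (σ i)) = F w)
    (w : Fin d → ι) : ofWords d F (∏ i, MvPolynomial.X (w i)) = F w := by
  classical
  have hm : (∏ i, MvPolynomial.X (w i) : MvPolynomial ι ℂ)
      = MvPolynomial.basisMonomials ι ℂ (∑ i, Finsupp.single (w i) 1) := by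
    rw [MvPolynomial.coe_basisMonomials]
    exact (MvPolynomial.monomial_sum_one _ _).symm
  have hex : ∃ w' : Fin d → ι, ∑ i, Finsupp.single (w' i) 1 = ∑ i, Finsupp.single (w i) 1 :=
    ⟨w, rfl⟩
  rw [hm, ofWords, Module.Basis.constr_basis, dif_pos hex]
  have key := congrArg Finsupp.toMultiset hex.choose_spec
  simp only [map_sum, Finsupp.toMultiset_single, one_smul] at key
  have hmap : ∀ u : Fin d → ι,
      ∑ i, ({u i} : Multiset ι) = (Finset.univ : Finset (Fin d)).val.map u := fun u => by
    rw [← Multiset.sum_map_singleton (Multiset.map u _), Multiset.map_map]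
    rfl
  rw [hmap, hmap] at key
  obtain ⟨σ, hσ⟩ : ∃ σ : Equiv.Perm (Fin d), hex.choose = fun i => w (σ i) := by
    have hcard : ∀ c : ι, Fintype.card {i // hex.choose i = c} = Fintype.card {i // w i = c} := by
      intro c
      have h := congrArg (Multiset.count c) key
      rw [Multiset.count_map, Multiset.count_map] at h
      simp only [Fintype.card_subtype, Finset.card, Finset.filter_val]
      simpa only [eq_comm] using h
    exact ⟨Equiv.ofFiberEquiv fun c => Fintype.equivOfCardEq (hcard c),
      funext fun i => (Equiv.ofFiberEquiv_map _ i).symm⟩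
  rw [hσ, hF]

/-- The complete polarization of `P` at `w_1, …, w_k`:
`(1/k!) ∑_{∅ ≠ I ⊆ [k]} (-1)^{k-|I|} P(∑_{i ∈ I} w_i)`. -/
def polarization {W M : Type*} [AddCommGroup W] [AddCommGroup M] [Module ℂ M] (k : ℕ)
    (P : W → M) (w : Fin k → W) : M :=
  (1 / (k ! : ℂ)) • ∑ I : Finset (Fin k) with I.Nonempty,
    (-1 : ℂ) ^ (k - I.card) • P (∑ i ∈ I, w i)

/-! ### The symmetric algebras of `V = ℂ³` and of `∧²V` -/

/-- `S^•V` for `V` with basis `e_1, e_2, e_3`, where `e_{i+1} = X i`. -/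
abbrev SymV : Type := MvPolynomial (Fin 3) ℂ

/-- The index set of the basis `e_i ∧ e_k`, `i < k`, of `∧²V`. -/
abbrev Pairs : Type := {p : Fin 3 × Fin 3 // p.1 < p.2}

/-- `S^•(∧²V)`; the degree `d` part `S^d(∧²V)` is `S_{(d,d)}V`. -/
abbrev SymWedge : Type := MvPolynomial Pairs ℂ

/-- `e_i ∧ e_k`, as an element of `∧²V ⊆ S^•(∧²V)`. -/
def wedge (i k : Fin 3) : SymWedge :=
  if h : i < k then MvPolynomial.X ⟨(i, k), h⟩
  else if h : k < i then -MvPolynomial.X ⟨(k, i), h⟩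
  else 0

/-! ### Brill's polynomial map and Brill's map -/

/-- The comultiplication `S^•V → S^•V ⊗ S^•V`, the algebra map with `v ↦ v ⊗ 1 + 1 ⊗ v`
for `v ∈ V`. -/
def comul : SymV →ₐ[ℂ] SymV ⊗[ℂ] SymV :=
  MvPolynomial.aeval fun i => MvPolynomial.X i ⊗ₜ[ℂ] 1 + 1 ⊗ₜ[ℂ] MvPolynomial.X i

/-- The `j`-th polarization `f_{j,δ-j} ∈ S^jV ⊗ S^{δ-j}V` of `f ∈ S^δV`; for a product
`f = l_1 ⋯ l_δ` of linear forms it is `∑_{|I| = j} l_I ⊗ l_{[δ] \ I}`. -/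
def polar (j : ℕ) (f : SymV) : SymV ⊗[ℂ] SymV :=
  LinearMap.rTensor SymV (MvPolynomial.homogeneousComponent j) (comul f)

/-- `E_j(f) = f_{j,δ-j} · (1 ⊗ f^{j-1})`. -/
def brillE (j : ℕ) (f : SymV) : SymV ⊗[ℂ] SymV :=
  polar j f * (1 ⊗ₜ[ℂ] f ^ (j - 1))

/-- Girard's formula `𝒫_d(x_1, …, x_d)` for the `d`-th power sum in terms of the elementary
symmetric functions; the indices are shifted, `x k` and `i k` standing for
`x_{k+1}` and `i_{k+1}`. -/
def girard {A : Type*} [CommRing A] [Algebra ℂ A] (d : ℕ) (x : Fin d → A) : A :=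
  ∑ i ∈ (Fintype.piFinset fun _ : Fin d => Finset.range (d + 1)) with
      ∑ k : Fin d, ((k : ℕ) + 1) * i k = d,
    ((d : ℂ) * (-1) ^ (d + ∑ k, i k) * (((∑ k, i k) - 1)! : ℂ) / ∏ k, ((i k)! : ℂ)) •
      ∏ k, x k ^ i k

/-- `Q_d(f) = 𝒫_d(E_1(f), …, E_d(f))`, for `f ∈ S^dV`. -/
def brillQ (d : ℕ) (f : SymV) : SymV ⊗[ℂ] SymV :=
  girard d fun k => brillE ((k : ℕ) + 1) f

/-- The projection `π_{d,d} : S^dV ⊗ S^dV → S_{(d,d)}V = S^d(∧²V)`, as a bilinear map,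
`(l_1 ⋯ l_d) ⊗ (m_1 ⋯ m_d) ↦ ∑_σ (l_1 ∧ m_{σ(1)}) ⋯ (l_d ∧ m_{σ(d)})`. -/
def piDD (d : ℕ) : SymV →ₗ[ℂ] SymV →ₗ[ℂ] SymWedge :=
  ofWords d fun l => ofWords d fun m =>
    ∑ σ : Equiv.Perm (Fin d), ∏ i, wedge (l i) (m (σ i))

/-- Brill's polynomial map `𝔅(f) = (π_{d,d} ⊗ id)(f ⊗ Q_d(f))`, for `f ∈ S^dV`. -/
def brillPoly (d : ℕ) (f : SymV) : SymWedge ⊗[ℂ] SymV :=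
  LinearMap.rTensor SymV (piDD d f) (brillQ d f)

/-- The index set of the monomial basis `e^a`, `|a| = d`, of `S^dV`. -/
abbrev MonoIdx (d : ℕ) : Type := {a : Fin 3 →₀ ℕ // a.degree = d}

/-- `S^•(S^dV)`, the polynomial algebra on the monomial basis of `S^dV`. -/
abbrev SymSymV (d : ℕ) : Type := MvPolynomial (MonoIdx d) ℂ

/-- Brill's map `𝔅̄ : S^{d+1}(S^dV) → S_{(d,d)}V ⊗ S^{d²-d}V`, the polarization of Brill's
polynomial map. -/
def brillMap (d : ℕ) : SymSymV d →ₗ[ℂ] SymWedge ⊗[ℂ] SymV :=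
  ofWords (d + 1) fun w =>
    polarization (d + 1) (brillPoly d) fun i => MvPolynomial.monomial (w i).1 1

/-- The multi-index of `e_1^{d-k} e_i^k`. -/
def monoIdx (d k : ℕ) (hk : k ≤ d) (i : Fin 3) : MonoIdx d :=
  ⟨Finsupp.single 0 (d - k) + Finsupp.single i k, by
    rw [map_add, Finsupp.degree_single, Finsupp.degree_single, Nat.sub_add_cancel hk]⟩

/-- The test vector `v_j = (e_1^{d-1} e_2)^d · (e_1^{d-j} e_3^j) ∈ S^{d+1}(S^dV)`. -/
def testVector (d j : ℕ) (hd : 1 ≤ d) (hj : j ≤ d) : SymSymV d :=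
  MvPolynomial.X (monoIdx d 1 hd 1) ^ d * MvPolynomial.X (monoIdx d j hj 2)

/-! ### Highest weight vectors of `S_{(d,d)}V ⊗ S^{d²-d}V` -/

/-- The subspace `S^d(∧²V) ⊗ S^{d²-d}V` of `S^•(∧²V) ⊗ S^•V`. -/
def targetSpace (d : ℕ) : Submodule ℂ (SymWedge ⊗[ℂ] SymV) :=
  LinearMap.range (TensorProduct.map
    (MvPolynomial.homogeneousSubmodule Pairs ℂ d).subtype
    (MvPolynomial.homogeneousSubmodule (Fin 3) ℂ (d ^ 2 - d)).subtype)

/-- The action on `S^•V` of `E^i_k ∈ 𝔤𝔩(V)`, where `E^i_k e_k = e_i` and `E^i_k e_l = 0` for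
`l ≠ k`. -/
def glSymV (i k : Fin 3) : SymV →ₗ[ℂ] SymV :=
  (MvPolynomial.mkDerivation ℂ fun l => if l = k then (MvPolynomial.X i : SymV) else 0).toLinearMap

/-- The action of `E^i_k ∈ 𝔤𝔩(V)` on `S^•(∧²V)`. -/
def glSymWedge (i k : Fin 3) : SymWedge →ₗ[ℂ] SymWedge :=
  (MvPolynomial.mkDerivation ℂ fun p : Pairs =>
    (if p.1.1 = k then wedge i p.1.2 else 0) +
      (if p.1.2 = k then wedge p.1.1 i else 0)).toLinearMap

/-- The action of `E^i_k ∈ 𝔤𝔩(V)` on `S^•(∧²V) ⊗ S^•V`. -/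
def glAct (i k : Fin 3) : SymWedge ⊗[ℂ] SymV →ₗ[ℂ] SymWedge ⊗[ℂ] SymV :=
  LinearMap.rTensor SymV (glSymWedge i k) + LinearMap.lTensor SymWedge (glSymV i k)

/-- `v` is a highest weight vector of weight `μ` in `S_{(d,d)}V ⊗ S^{d²-d}V`: a nonzero weight
vector that is killed by all raising operators `E^i_k`, `i < k`. -/
def IsHighestWeightVector (d : ℕ) (μ : Fin 3 → ℕ) (v : SymWedge ⊗[ℂ] SymV) : Prop :=
  v ∈ targetSpace d ∧ v ≠ 0 ∧ (∀ i, glAct i i v = (μ i : ℂ) • v) ∧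
    ∀ i k, i < k → glAct i k v = 0

/-- The vector `ṽ_j = ∑_{s=0}^j ∑_{t=0}^s (-1)^t (j choose s) (s choose t)
(e_1∧e_2)^{d+s-j-t} (e_1∧e_3)^t (e_2∧e_3)^{j-s} ⊗ e_1^{d²-d-s} e_2^t e_3^{s-t}`. -/
def hwVector (d j : ℕ) : SymWedge ⊗[ℂ] SymV :=
  ∑ s ∈ Finset.range (j + 1), ∑ t ∈ Finset.range (s + 1),
    ((-1 : ℂ) ^ t * (j.choose s : ℂ) * (s.choose t : ℂ)) •
      ((wedge 0 1 ^ (d + s - j - t) * wedge 0 2 ^ t * wedge 1 2 ^ (j - s)) ⊗ₜ[ℂ]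
        (MvPolynomial.X 0 ^ (d ^ 2 - d - s) * MvPolynomial.X 1 ^ t * MvPolynomial.X 2 ^ (s - t)))

/-! ### The Hermitian inner product -/

/-- The tensor power `V^{⊗(d²+d)}` with the Hermitian inner product for which the tensors
`e_{i_1} ⊗ e_{i_2} ⊗ ⋯` are orthonormal; a tensor is given by its coordinates in this basis.
The tensor factors are labelled by `Fin d × Fin 2` (the factors of the `d` bivectors)
and `Fin (d² - d)`. -/
abbrev TensorPower (d : ℕ) : Type :=
  EuclideanSpace ℂ ((Fin d × Fin 2) ⊕ Fin (d ^ 2 - d) → Fin 3)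

/-- The coordinate at `e_x ⊗ e_y` of `e_i ∧ e_k = (1/2) (e_i ⊗ e_k - e_k ⊗ e_i)`, for
`p = (i, k)`. -/
def wedgeCoord (p : Fin 3 × Fin 3) (x y : Fin 3) : ℂ :=
  1 / 2 * ((if x = p.1 ∧ y = p.2 then 1 else 0) - (if x = p.2 ∧ y = p.1 then 1 else 0))

/-- The inclusion `S^d(∧²V) ⊗ S^{d²-d}V ⊆ V^{⊗(d²+d)}`, where products are symmetrized:
`u_1 ⋯ u_n` is the tensor `(1/n!) ∑_σ u_{σ(1)} ⊗ ⋯ ⊗ u_{σ(n)}`. -/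
def toTensor (d : ℕ) : SymWedge ⊗[ℂ] SymV →ₗ[ℂ] TensorPower d :=
  TensorProduct.lift <|
    ofWords d fun p => ofWords (d ^ 2 - d) fun q => WithLp.toLp 2 fun c =>
      (1 / (d ! : ℂ) * ∑ σ : Equiv.Perm (Fin d),
        ∏ i, wedgeCoord (p (σ i)).1 (c (Sum.inl (i, 0))) (c (Sum.inl (i, 1)))) *
      (1 / ((d ^ 2 - d)! : ℂ) * ∑ τ : Equiv.Perm (Fin (d ^ 2 - d)),
        ∏ i, if c (Sum.inr i) = q (τ i) then (1 : ℂ) else 0)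

/-- The Hermitian inner product `⟨x, y⟩` on `S^d(∧²V) ⊗ S^{d²-d}V ⊆ V^{⊗(d²+d)}`, linear in `x`
and conjugate-linear in `y`. -/
def herm (d : ℕ) (x y : SymWedge ⊗[ℂ] SymV) : ℂ :=
  inner ℂ (toTensor d y) (toTensor d x)

end BrillMap

end

/-!
Let `g = e_1^{d-1} e_2` and `h = e_1^{d-j} e_3^j`. The polarization `𝔅̄(v_j)` is `1/(d+1)` times the
first-order term of `𝔅(g + ε h)` in `ε` (`brillMap_testVector`), which is
`π_{d,d}(g) (Q_d'(g)[h]) + π_{d,d}(h) (Q_d(g))`.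

The computation of `Q_d` rests on Girard's formula being a logarithmic derivative: `𝒫_d(x)` is
`(-1)^{d-1}` times the coefficient of `T^{d-1}` in `E'/E`, where `E = 1 + ∑ x_k T^k`
(`girard_eq_coeff_logDeriv`). The polarizations of `f` are the coefficients of the Taylor expansion
`f(y + T x)`, where `x_i = e_i ⊗ 1` and `y_i = 1 ⊗ e_i` (`coeff_taylor`), so that
`Q_d(f) = (-1)^{d-1} f(y)^d [T^{d-1}] (log f(y + T x))'`. For the product `g` of linear forms this
is `(d-1) e_1^d ⊗ (e_1^{d-2} e_2)^d + e_2^d ⊗ (e_1^{d-1})^d` (`toPoly_coeff_zero_brillQLine`), and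
the same formula over the dual numbers gives the variation of `Q_d` in the direction `h`: up to
multiples of `e_1^d ⊗ _` and `e_2^d ⊗ _` it is `(-1)^{d-1} d g(y)^d [T^d] h(y + T x) / g(y + T x)`
(`toPoly_coeff_brillQLine`, `coeff_toPoly_coeff_one_brillQLine`). The quotient is a product of power
series in one variable each, so its coefficients are explicit.

Since `e_1 ∧ e_1 = 0`, the contraction with `g` only sees monomials in which `e_1` occurs at most
once (`rTensor_piDD_X_mul_X_pow`). The two cases give the two sums of the formula, and the
contraction of `Q_d(g)` with `h` gives its last term and, if `j = d`, the summand `t = d` of the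
first sum (`herm_rTensor_coeff_one`, `herm_rTensor_coeff_zero`). All the tensors that occur are
multiples of monomials of `ṽ_j`, and distinct monomials are orthogonal (`herm_monomial`).

That `ṽ_j` is a highest weight vector is seen from its factorization into powers of `e_1 ∧ e_2`,
of `e_1` and of the determinant, an `𝔰𝔩(V)`-invariant of `∧²V ⊗ V` (`hwVector_eq_mul_pow`).

For the vanishing, the two sums are evaluated by the hockey-stick identity. Up to a nonzero factor
the pairing is
`((j-1)(d+1) + j (N-j+1)) d(d-1)⋯(d-j+2) + (-1)^j N(N-1)⋯(N-j+1)`, with `N = d² - d`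
(`pairing_summands_eq`). For even `j ≥ 2` it is positive. For odd `j ≥ 3` and `d ≥ 4` the last
product dominates, because `N - i ≥ (d-1)(d-i)` (`descFactorial_estimate`); the remaining cases are
`j ≤ 1` and `d = j = 3`, in which the terms cancel.
-/

open scoped TensorProduct Nat

noncomputable section

namespace BrillMap

/-! ### Girard's formula as a logarithmic derivative -/

section Girard

open PowerSeries

variable {A B : Type*} [CommRing A] [Algebra ℂ A] [CommRing B] [Algebra ℂ B]

/-- Girard's polynomial is, up to a factor, the coefficient of `T^d` in
`log (1 + ∑ x_k T^{k+1})`; this is the multinomial theorem. -/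
theorem girard_eq_sum_coeff_pow {d : ℕ} (hd : 1 ≤ d) (x : Fin d → A) :
    girard d x = ∑ m ∈ Finset.Icc 1 d, ((d : ℂ) * (-1) ^ (d + m) / m) •
      coeff d ((∑ k : Fin d, C (x k) * (X : A⟦X⟧) ^ ((k : ℕ) + 1)) ^ m) := by
  have hexp : ∀ m, coeff d ((∑ k : Fin d, C (x k) * (X : A⟦X⟧) ^ ((k : ℕ) + 1)) ^ m) =
      ∑ i ∈ (Finset.piAntidiag (Finset.univ : Finset (Fin d)) m) with
        ∑ k : Fin d, ((k : ℕ) + 1) * i k = d,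
        (Nat.multinomial Finset.univ i : A) * ∏ k, x k ^ i k := by
    intro m
    rw [Finset.sum_pow_eq_sum_piAntidiag, map_sum, Finset.sum_filter]
    refine Finset.sum_congr rfl fun i _ => ?_
    have h1 : (∏ k : Fin d, (C (x k) * (X : A⟦X⟧) ^ ((k : ℕ) + 1)) ^ i k) =
        C (∏ k, x k ^ i k) * X ^ (∑ k : Fin d, ((k : ℕ) + 1) * i k) := by
      simp only [mul_pow, Finset.prod_mul_distrib, map_prod, map_pow, ← pow_mul,
        Finset.prod_pow_eq_pow_sum]
    rw [h1, ← map_natCast (C (R := A)), ← mul_assoc, ← map_mul, coeff_C_mul, coeff_X_pow]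
    split_ifs with h h' h'
    · rw [mul_one]
    · exact absurd h.symm h'
    · exact absurd h'.symm h
    · rw [mul_zero]
  simp only [hexp]
  have hle : ∀ i : Fin d → ℕ, ∑ k : Fin d, ((k : ℕ) + 1) * i k = d → ∑ k, i k ≤ d :=
    fun i hi => (Finset.sum_le_sum fun k _ => Nat.le_mul_of_pos_left _ (Nat.succ_pos _)).trans hi.le
  rw [girard, ← Finset.sum_fiberwise_of_maps_to (t := Finset.Icc 1 d) (g := fun i => ∑ k, i k)]
  · refine Finset.sum_congr rfl fun m hm => ?_
    rw [Finset.smul_sum]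
    refine Finset.sum_congr ?_ fun i hi => ?_
    · ext i
      simp only [Finset.mem_filter, Fintype.mem_piFinset, Finset.mem_range, Finset.mem_piAntidiag,
        Finset.mem_univ, implies_true, and_true]
      constructor
      · rintro ⟨⟨-, h⟩, h'⟩
        exact ⟨h', h⟩
      · rintro ⟨h', h⟩
        exact ⟨⟨fun k => Nat.lt_succ_of_le
          ((Finset.single_le_sum (fun _ _ => Nat.zero_le _) (Finset.mem_univ k)).trans (hle i h)),
          h⟩, h'⟩
    · simp only [Finset.mem_filter, Finset.mem_piAntidiag] at hi
      obtain ⟨⟨hs, -⟩, -⟩ := hi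
      obtain ⟨m, rfl⟩ : ∃ n, m = n + 1 := ⟨m - 1, by simp at hm; omega⟩
      have hsp := Nat.multinomial_spec (Finset.univ : Finset (Fin d)) i
      rw [hs] at hsp
      have hp : (∏ k, ((i k)! : ℂ)) ≠ 0 :=
        Finset.prod_ne_zero_iff.2 fun k _ => by exact_mod_cast Nat.factorial_ne_zero _
      have hm1 : ((m : ℂ) + 1) ≠ 0 := by exact_mod_cast Nat.succ_ne_zero m
      have hsp' : (∏ k, ((i k)! : ℂ)) * (Nat.multinomial Finset.univ i : ℂ)
          = ((m : ℂ) + 1) * (m ! : ℂ) := by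
        rw [Nat.factorial_succ] at hsp
        exact_mod_cast hsp
      rw [hs, ← map_natCast (algebraMap ℂ A), ← Algebra.smul_def, smul_smul]
      congr 1
      rw [Nat.add_sub_cancel]
      push_cast
      field_simp
      linear_combination -(d : ℂ) * hsp'
  · intro i hi
    rw [Finset.mem_filter] at hi
    rw [Finset.mem_Icc]
    refine ⟨Nat.one_le_iff_ne_zero.2 fun h0 => ?_, hle i hi.2⟩
    have : ∀ k, i k = 0 := fun k => Finset.sum_eq_zero_iff.1 h0 k (Finset.mem_univ k)
    have h2 := hi.2
    simp only [this, mul_zero, Finset.sum_const_zero] at h2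
    omega

/-- `𝒫_d` is read off from the logarithmic derivative of `E = 1 + ∑ x_k T^{k+1}`. -/
theorem girard_eq_coeff_logDeriv {d : ℕ} (hd : 1 ≤ d) (x : Fin d → A) (E J : A⟦X⟧)
    (hE : E = 1 + ∑ k : Fin d, C (x k) * (X : A⟦X⟧) ^ ((k : ℕ) + 1)) (hJ : E * J = 1) :
    girard d x = (-1) ^ (d - 1) * coeff (d - 1) (derivative A E * J) := by
  obtain ⟨n, rfl⟩ : ∃ n, d = n + 1 := ⟨d - 1, by omega⟩
  set u : A⟦X⟧ := ∑ k : Fin (n + 1), C (x k) * (X : A⟦X⟧) ^ ((k : ℕ) + 1) with hu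
  have hX : X ∣ u := Finset.dvd_sum fun k _ => Dvd.dvd.mul_left (dvd_pow_self _ (by omega)) _
  have hDE : derivative A E = derivative A u := by rw [hE, map_add]; simp
  -- `d [T^d] u^m / m = [T^{d-1}] u^{m-1} u'`
  have hterm : ∀ m ∈ Finset.Icc 1 (n + 1),
      (((n + 1 : ℕ) : ℂ) * (-1) ^ (n + 1 + m) / m) • coeff (n + 1) (u ^ m) =
        (-1) ^ n * coeff n ((-u) ^ (m - 1) * derivative A u) := by
    intro m hm
    obtain ⟨m, rfl⟩ : ∃ k, m = k + 1 := ⟨m - 1, by simp at hm; omega⟩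
    have h1 := congrArg (coeff n) (derivative_pow u (m + 1))
    rw [coeff_derivative, Nat.add_sub_cancel] at h1
    have hm1 : (((m + 1 : ℕ) : ℂ)) ≠ 0 := by exact_mod_cast Nat.succ_ne_zero m
    have h2 : (((n + 1 : ℕ) : ℂ)) • coeff (n + 1) (u ^ (m + 1)) =
        ((m + 1 : ℕ) : ℂ) • coeff n (u ^ m * derivative A u) := by
      rw [Nat.cast_smul_eq_nsmul ℂ, Nat.cast_smul_eq_nsmul ℂ, nsmul_eq_mul, nsmul_eq_mul,
        mul_comm]
      push_cast at h1 ⊢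
      rw [h1, mul_assoc, ← map_natCast (C (R := A)), ← map_one (C (R := A)), ← map_add,
        coeff_C_mul]
    have h3 : (((n + 1 : ℕ) : ℂ) * (-1) ^ (n + 1 + (m + 1)) / ((m + 1 : ℕ) : ℂ)) =
        ((-1) ^ (n + m) / ((m + 1 : ℕ) : ℂ)) * ((n + 1 : ℕ) : ℂ) := by ring
    rw [h3, mul_smul, h2, smul_smul, div_mul_cancel₀ _ hm1, Nat.add_sub_cancel, neg_pow u,
      mul_assoc, ← map_one (C (R := A)), ← map_neg, ← map_pow, coeff_C_mul, ← mul_assoc,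
      ← pow_add, Algebra.smul_def]
    simp
  rw [girard_eq_sum_coeff_pow hd, Finset.sum_congr rfl hterm, ← Finset.mul_sum, ← map_sum,
    ← Finset.sum_mul, Nat.add_sub_cancel, hDE]
  congr 1
  have hgeom : (∑ m ∈ Finset.Icc 1 (n + 1), (-u) ^ (m - 1)) = (1 - (-u) ^ (n + 1)) * J := by
    have h1 : (∑ m ∈ Finset.Icc 1 (n + 1), (-u) ^ (m - 1)) =
        ∑ m ∈ Finset.range (n + 1), (-u) ^ m := by
      rw [Finset.range_eq_Ico]
      exact (Finset.sum_Ico_add' (fun m => (-u) ^ (m - 1)) 0 (n + 1) 1).symm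
    have h2 := geom_sum_mul_neg (-u) (n + 1)
    rw [sub_neg_eq_add, ← hE] at h2
    rw [h1, ← h2, mul_assoc, hJ, mul_one]
  rw [hgeom]
  have hdvd : X ^ (n + 1) ∣ (-u) ^ (n + 1) * J * derivative A u :=
    Dvd.dvd.mul_right (Dvd.dvd.mul_right (pow_dvd_pow_of_dvd ((dvd_neg).2 hX) _) _) _
  have h0 := (X_pow_dvd_iff.1 hdvd) n (Nat.lt_succ_self n)
  have h4 : (1 - (-u) ^ (n + 1)) * J * derivative A u =
    derivative A u * J - (-u) ^ (n + 1) * J * derivative A u := by ring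
  rw [h4, map_sub, h0, sub_zero]

theorem map_girard (F : A →ₐ[ℂ] B) (d : ℕ) (x : Fin d → A) :
    F (girard d x) = girard d fun k => F (x k) := by
  simp only [girard, map_sum, map_smul, map_prod, map_pow]

/-- `𝒫_d` is weighted homogeneous of degree `d`. -/
theorem girard_pow_mul (d : ℕ) (c : A) (x : Fin d → A) :
    girard d (fun k => c ^ ((k : ℕ) + 1) * x k) = c ^ d * girard d x := by
  simp only [girard]
  rw [Finset.mul_sum]
  refine Finset.sum_congr rfl fun i hi => ?_
  rw [Finset.mem_filter] at hi
  rw [mul_smul_comm]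
  congr 1
  simp only [mul_pow, Finset.prod_mul_distrib, ← pow_mul]
  rw [Finset.prod_pow_eq_pow_sum, hi.2]

/-- Girard's polynomial at `N_{k+1} N_0^k`, where `N = ∑ N_k T^k` is invertible of degree at
most `d`. -/
theorem girard_coeff_mul_pow {d : ℕ} (hd : 1 ≤ d) (N J : A⟦X⟧) (hJ : N * J = 1)
    (hN : ∀ k, d < k → coeff k N = 0) :
    girard d (fun k => coeff ((k : ℕ) + 1) N * coeff 0 N ^ (k : ℕ)) =
      (-1) ^ (d - 1) * (coeff 0 N ^ d * coeff (d - 1) (derivative A N * J)) := by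
  have h0 : coeff 0 N * coeff 0 J = 1 := by
    have := congrArg (coeff 0) hJ
    simpa [coeff_zero_eq_constantCoeff] using this
  have hx : (fun k : Fin d => coeff ((k : ℕ) + 1) N * coeff 0 N ^ (k : ℕ)) =
      fun k : Fin d => coeff 0 N ^ ((k : ℕ) + 1) * (coeff 0 J * coeff ((k : ℕ) + 1) N) := by
    funext k
    linear_combination (-coeff 0 N ^ (k : ℕ) * coeff ((k : ℕ) + 1) N) * h0
  rw [hx, girard_pow_mul, girard_eq_coeff_logDeriv hd _ (C (coeff 0 J) * N) (C (coeff 0 N) * J)]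
  · have h1 : derivative A (C (coeff 0 J) * N) * (C (coeff 0 N) * J) = derivative A N * J := by
      rw [Derivation.leibniz, derivative_C, smul_zero, add_zero, smul_eq_mul]
      have : (C (coeff 0 N) : A⟦X⟧) * C (coeff 0 J) = 1 := by rw [← map_mul, h0, map_one]
      linear_combination (derivative A N * J) * this
    rw [h1]
    ring
  · ext n
    rw [coeff_C_mul, map_add, map_sum, coeff_one]
    simp only [coeff_C_mul, coeff_X_pow]
    rcases n with _ | n
    · simp only [↓reduceIte]
      rw [Finset.sum_eq_zero, add_zero, mul_comm, h0]
      intro k _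
      simp
    · simp only [Nat.add_right_cancel_iff, Nat.succ_ne_zero, if_false, zero_add, mul_ite, mul_one,
        mul_zero]
      by_cases hn : n < d
      · rw [Finset.sum_eq_single (⟨n, hn⟩ : Fin d)]
        · simp
        · intro k _ hk
          exact if_neg fun h => hk (Fin.ext h.symm)
        · simp
      · rw [Finset.sum_eq_zero, hN _ (by omega), mul_zero]
        intro k _
        exact if_neg (by have := k.2; omega)
  · have : (C (coeff 0 J) : A⟦X⟧) * C (coeff 0 N) = 1 := by rw [← map_mul, mul_comm, h0, map_one]
    linear_combination C (coeff 0 J) * C (coeff 0 N) * hJ + this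

/-- By weighted homogeneity: if `x k` is a polynomial of degree at most `k + 1`, then `𝒫_d(x)` has
degree at most `d`. -/
theorem natDegree_girard_le (d : ℕ) (x : Fin d → Polynomial A)
    (hx : ∀ k, (x k).natDegree ≤ (k : ℕ) + 1) : (girard d x).natDegree ≤ d := by
  refine Polynomial.natDegree_sum_le_of_forall_le _ _ fun i hi => ?_
  rw [Finset.mem_filter] at hi
  refine (Polynomial.natDegree_smul_le _ _).trans ((Polynomial.natDegree_prod_le _ _).trans ?_)
  refine (Finset.sum_le_sum fun k _ => Polynomial.natDegree_pow_le_of_le (i k) (hx k)).trans ?_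
  simp only [mul_comm (i _)]
  exact hi.2.le

theorem coeff_prod_pow_of_natDegree_le {ι R : Type*} [CommSemiring R] (s : Finset ι)
    (x : ι → Polynomial R) (w i : ι → ℕ) (hx : ∀ k, (x k).natDegree ≤ w k) :
    (∏ k ∈ s, x k ^ i k).coeff (∑ k ∈ s, w k * i k) = ∏ k ∈ s, (x k).coeff (w k) ^ i k := by
  classical
  induction s using Finset.induction_on with
  | empty => simp
  | insert a s ha ih =>
    rw [Finset.prod_insert ha, Finset.sum_insert ha, Finset.prod_insert ha,
      Polynomial.coeff_mul_add_eq_of_natDegree_le, ih, mul_comm (w a),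
      Polynomial.coeff_pow_of_natDegree_le (hx a)]
    · rw [mul_comm]
      exact Polynomial.natDegree_pow_le_of_le _ (hx a)
    · refine (Polynomial.natDegree_prod_le _ _).trans (Finset.sum_le_sum fun k _ => ?_)
      rw [mul_comm]
      exact Polynomial.natDegree_pow_le_of_le _ (hx k)

theorem coeff_girard (d : ℕ) (x : Fin d → Polynomial A)
    (hx : ∀ k, (x k).natDegree ≤ (k : ℕ) + 1) :
    (girard d x).coeff d = girard d fun k => (x k).coeff ((k : ℕ) + 1) := by
  simp only [girard, Polynomial.finsetSum_coeff, Polynomial.coeff_smul]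
  refine Finset.sum_congr rfl fun i hi => ?_
  rw [Finset.mem_filter] at hi
  congr 1
  refine (congrArg _ hi.2.symm).trans ?_
  exact coeff_prod_pow_of_natDegree_le _ x (fun k => (k : ℕ) + 1) i hx

end Girard

/-! ### Polarization -/

/-- The `d`-th finite difference of `r ↦ r^i` at `0`. -/
theorem sum_choose_mul_pow {d i : ℕ} (hi : i ≤ d) :
    ∑ m ∈ Finset.range (d + 1), ((-1 : ℂ) ^ (d - m) * d.choose m) * (m : ℂ) ^ i =
      if i = d then (d ! : ℂ) else 0 := by
  have h := fwdDiff_iter_eq_sum_shift (1 : ℂ) (fun r : ℂ => r ^ i) d 0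
  have h1 : ∑ m ∈ Finset.range (d + 1), ((-1 : ℂ) ^ (d - m) * d.choose m) * (m : ℂ) ^ i =
      (fwdDiff (1 : ℂ))^[d] (fun r : ℂ => r ^ i) 0 := by
    rw [h]
    refine Finset.sum_congr rfl fun m _ => ?_
    simp [zsmul_eq_mul]
  rw [h1]
  split_ifs with hid
  · subst hid
    rw [fwdDiff_iter_eq_factorial]
    simp
  · rw [fwdDiff_iter_pow_eq_zero_of_lt (lt_of_le_of_ne hi hid)]
    rfl

section Polarization

variable {W M : Type*} [AddCommGroup W] [AddCommGroup M] [Module ℂ M]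

theorem polarization_comp_perm (k : ℕ) (P : W → M) (w : Fin k → W) (σ : Equiv.Perm (Fin k)) :
    polarization k P (fun i => w (σ i)) = polarization k P w := by
  rw [polarization, polarization]
  congr 1
  refine Finset.sum_equiv (Equiv.finsetCongr σ) (fun I => ?_) fun I _ => ?_
  · simp
  · rw [Equiv.finsetCongr_apply, Finset.card_map, Finset.sum_map]
    rfl

/-- The complete polarization of a homogeneous polynomial map of degree `d + 1` at
`h, g, …, g` is `1/(d+1)` times its first-order variation `p 1` at `g` in the direction `h`. -/
theorem polarization_cons_const [Module ℂ W] (d : ℕ) (P : W → M) (g h : W) (p : ℕ → M)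
    (hP : ∀ a b : ℂ, P (a • g + b • h) =
      ∑ i ∈ Finset.range (d + 2), (a ^ (d + 1 - i) * b ^ i) • p i) :
    polarization (d + 1) P (Fin.cons h fun _ : Fin d => g) = (1 / ((d : ℂ) + 1)) • p 1 := by
  classical
  set w : Fin (d + 1) → W := Fin.cons h fun _ : Fin d => g with hw
  have hP0 : P 0 = 0 := by
    have := hP 0 0
    simp only [zero_smul, add_zero] at this
    rw [this]
    refine Finset.sum_eq_zero fun i hi => ?_
    rcases i with _ | i <;> simp
  have hins : (Finset.univ : Finset (Fin (d + 1))) =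
      insert 0 (Finset.univ.map (Fin.succEmb d)) := by
    ext i
    refine Fin.cases ?_ (fun i => ?_) i <;> simp
  have hnot : (0 : Fin (d + 1)) ∉ (Finset.univ.map (Fin.succEmb d)) := by simp
  have hsum : ∀ I ∈ (Finset.univ.map (Fin.succEmb d)).powerset,
      ∑ i ∈ I, w i = (I.card : ℂ) • g := by
    intro I hI
    rw [Nat.cast_smul_eq_nsmul, ← Finset.sum_const]
    refine Finset.sum_congr rfl fun i hi => ?_
    obtain ⟨k, -, rfl⟩ := Finset.mem_map.1 (Finset.mem_powerset.1 hI hi)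
    rfl
  have hmain : ∑ I : Finset (Fin (d + 1)) with I.Nonempty,
      (-1 : ℂ) ^ (d + 1 - I.card) • P (∑ i ∈ I, w i) = (d ! : ℂ) • p 1 := by
    have h1 : ∑ I : Finset (Fin (d + 1)) with I.Nonempty,
        (-1 : ℂ) ^ (d + 1 - I.card) • P (∑ i ∈ I, w i) =
        ∑ I ∈ (Finset.univ : Finset (Fin (d + 1))).powerset,
          (-1 : ℂ) ^ (d + 1 - I.card) • P (∑ i ∈ I, w i) := by
      rw [Finset.powerset_univ]
      refine Finset.sum_filter_of_ne fun I _ hne => ?_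
      by_contra hI
      rw [Finset.not_nonempty_iff_eq_empty] at hI
      exact hne (by rw [hI, Finset.sum_empty, hP0, smul_zero])
    rw [h1, hins, Finset.sum_powerset_insert hnot, ← Finset.sum_add_distrib]
    -- the subsets of `{1, …, d}` are paired with those that contain `0` as well
    let F : ℕ → M := fun m => (-1 : ℂ) ^ (d - m) • ∑ i ∈ Finset.range (d + 1),
      ((m : ℂ) ^ (d - i)) • p (i + 1)
    have h2 : ∀ I ∈ (Finset.univ.map (Fin.succEmb d)).powerset,
        (-1 : ℂ) ^ (d + 1 - I.card) • P (∑ i ∈ I, w i) +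
          (-1 : ℂ) ^ (d + 1 - (insert 0 I).card) • P (∑ i ∈ insert 0 I, w i) =
        F I.card := by
      intro I hI
      have h0 : (0 : Fin (d + 1)) ∉ I := fun h => hnot (Finset.mem_powerset.1 hI h)
      have hc : I.card ≤ d := by
        have := Finset.card_le_card (Finset.mem_powerset.1 hI)
        simpa using this
      have hw0 : w 0 = h := rfl
      rw [Finset.sum_insert h0, Finset.card_insert_of_notMem h0, hsum I hI, hw0]
      have e1 := hP (I.card : ℂ) 1
      have e0 := hP (I.card : ℂ) 0
      rw [one_smul] at e1
      rw [zero_smul, add_zero] at e0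
      rw [add_comm h, e1, e0, show d + 1 - I.card = (d - I.card) + 1 by omega,
        show d + 1 - (I.card + 1) = d - I.card by omega, pow_succ, mul_neg_one, neg_smul,
        neg_add_eq_sub, ← smul_sub, ← Finset.sum_sub_distrib, Finset.sum_range_succ']
      simp [F]
    rw [Finset.sum_congr rfl h2, Finset.sum_powerset_apply_card F, Finset.card_map,
      Finset.card_univ, Fintype.card_fin]
    simp only [F, ← Nat.cast_smul_eq_nsmul ℂ, Finset.smul_sum, smul_smul]
    rw [Finset.sum_comm]
    simp only [← Finset.sum_smul]
    have h3 : ∀ i ∈ Finset.range (d + 1),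
        (∑ m ∈ Finset.range (d + 1), (d.choose m : ℂ) * ((-1) ^ (d - m) * (m : ℂ) ^ (d - i))) =
          if i = 0 then (d ! : ℂ) else 0 := by
      intro i hi
      rw [Finset.mem_range] at hi
      rw [← if_congr (show d - i = d ↔ i = 0 by omega) rfl rfl,
        ← sum_choose_mul_pow (Nat.sub_le d i)]
      exact Finset.sum_congr rfl fun m _ => by ring
    rw [Finset.sum_congr rfl fun i hi => by rw [h3 i hi]]
    simp
  rw [polarization, hmain, smul_smul, Nat.factorial_succ]
  congr 1
  have hd : (d ! : ℂ) ≠ 0 := by exact_mod_cast Nat.factorial_ne_zero _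
  have hd' : ((d : ℂ) + 1) ≠ 0 := by exact_mod_cast Nat.succ_ne_zero d
  push_cast
  field_simp

end Polarization

/-! ### The highest weight vector -/

theorem glAct_mul (i k : Fin 3) (x y : SymWedge ⊗[ℂ] SymV) :
    glAct i k (x * y) = glAct i k x * y + x * glAct i k y := by
  induction x using TensorProduct.induction_on with
  | zero => simp
  | add x x' hx hx' => rw [add_mul, map_add, hx, hx', map_add]; ring
  | tmul p q =>
    induction y using TensorProduct.induction_on with
    | zero => simp
    | add y y' hy hy' => rw [mul_add, map_add, hy, hy', map_add]; ring
    | tmul p' q' =>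
      simp only [glAct, glSymV, glSymWedge, LinearMap.add_apply, LinearMap.rTensor_tmul,
        LinearMap.lTensor_tmul, Algebra.TensorProduct.tmul_mul_tmul, Derivation.coeFn_coe,
        Derivation.leibniz, smul_eq_mul, TensorProduct.add_tmul, TensorProduct.tmul_add, add_mul,
        mul_add]
      rw [mul_comm p', mul_comm q']
      abel

/-- Weights add under multiplication. -/
theorem glAct_mul_of_smul {i k : Fin 3} {x y : SymWedge ⊗[ℂ] SymV} {a b : ℂ}
    (hx : glAct i k x = a • x) (hy : glAct i k y = b • y) :
    glAct i k (x * y) = (a + b) • (x * y) := by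
  rw [glAct_mul, hx, hy, smul_mul_assoc, mul_smul_comm, add_smul]

theorem glAct_pow_of_smul {i k : Fin 3} {x : SymWedge ⊗[ℂ] SymV} {a : ℂ}
    (hx : glAct i k x = a • x) (n : ℕ) : glAct i k (x ^ n) = ((n : ℂ) * a) • x ^ n := by
  induction n with
  | zero => simp [glAct, glSymV, glSymWedge, Algebra.TensorProduct.one_def]
  | succ n ih =>
    rw [pow_succ, glAct_mul_of_smul ih hx]
    push_cast
    rw [add_mul, one_mul]

/-- The `𝔰𝔩(V)`-invariant of `∧²V ⊗ V` given by the determinant. -/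
def detVector : SymWedge ⊗[ℂ] SymV :=
  wedge 1 2 ⊗ₜ MvPolynomial.X 0 - wedge 0 2 ⊗ₜ MvPolynomial.X 1 + wedge 0 1 ⊗ₜ MvPolynomial.X 2

/-- `ṽ_j` is a product of powers of three highest weight vectors. -/
theorem hwVector_eq_mul_pow {d j : ℕ} (hd : 2 ≤ d) (hj : j ≤ d) :
    hwVector d j = (wedge 0 1 ⊗ₜ[ℂ] (1 : SymV)) ^ (d - j) *
      ((1 : SymWedge) ⊗ₜ[ℂ] (MvPolynomial.X 0 : SymV)) ^ (d ^ 2 - d - j) * detVector ^ j := by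
  have hN : d ≤ d ^ 2 - d := Nat.le_sub_of_add_le (by nlinarith)
  have hω : detVector = ((-wedge 0 2) ⊗ₜ MvPolynomial.X 1 + wedge 0 1 ⊗ₜ MvPolynomial.X 2) +
      wedge 1 2 ⊗ₜ MvPolynomial.X 0 := by
    rw [detVector, TensorProduct.neg_tmul]; abel
  rw [hω, add_pow, Finset.mul_sum, hwVector]
  refine Finset.sum_congr rfl fun s hs => ?_
  rw [add_pow, Finset.sum_mul, Finset.sum_mul, Finset.mul_sum]
  refine Finset.sum_congr rfl fun t ht => ?_
  rw [Finset.mem_range, Nat.lt_succ_iff] at hs ht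
  have hc : ∀ n : ℕ, ((n : ℕ) : SymWedge ⊗[ℂ] SymV) = algebraMap ℂ _ (n : ℂ) :=
    fun n => (map_natCast _ n).symm
  have ht' : ∀ (a : SymWedge) (b : SymV), a ⊗ₜ[ℂ] b =
      Algebra.TensorProduct.includeLeft (R := ℂ) (S := ℂ) a *
        Algebra.TensorProduct.includeRight b := by simp
  have hsm : ∀ (c : ℂ) (x : SymWedge ⊗[ℂ] SymV), c • x = algebraMap ℂ _ c * x :=
    fun c x => Algebra.smul_def c x
  rw [hc, hc, show d + s - j - t = (d - j) + (s - t) by omega,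
    show d ^ 2 - d - s = (d ^ 2 - d - j) + (j - s) by omega, hsm]
  simp only [ht', map_mul, map_pow, map_one, map_neg]
  ring

theorem hwVector_mem_targetSpace {d j : ℕ} (hd : 2 ≤ d) (hj : j ≤ d) :
    hwVector d j ∈ targetSpace d := by
  have hN : d ≤ d ^ 2 - d := Nat.le_sub_of_add_le (by nlinarith)
  refine Submodule.sum_mem _ fun s hs => Submodule.sum_mem _ fun t ht => Submodule.smul_mem _ _ ?_
  rw [Finset.mem_range, Nat.lt_succ_iff] at hs ht
  have hw : ∀ i k : Fin 3, i < k → (wedge i k).IsHomogeneous 1 := fun i k h => by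
    rw [wedge, dif_pos h]
    exact MvPolynomial.isHomogeneous_X _ _
  have hX : ∀ i : Fin 3, (MvPolynomial.X i : SymV).IsHomogeneous 1 :=
    fun i => MvPolynomial.isHomogeneous_X _ _
  have h1 := (((hw 0 1 (by decide)).pow (d + s - j - t)).mul ((hw 0 2 (by decide)).pow t)).mul
    ((hw 1 2 (by decide)).pow (j - s))
  have h2 := (((hX 0).pow (d ^ 2 - d - s)).mul ((hX 1).pow t)).mul ((hX 2).pow (s - t))
  rw [show 1 * (d + s - j - t) + 1 * t + 1 * (j - s) = d by omega] at h1
  rw [show 1 * (d ^ 2 - d - s) + 1 * t + 1 * (s - t) = d ^ 2 - d by omega] at h2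
  exact ⟨⟨_, h1⟩ ⊗ₜ ⟨_, h2⟩, rfl⟩

theorem hwVector_ne_zero {d j : ℕ} (hd : 2 ≤ d) (hj : j ≤ d) : hwVector d j ≠ 0 := by
  intro h
  rw [hwVector_eq_mul_pow hd hj] at h
  -- the three factors take the value `1` at `e_1 ∧ e_2 = 1`, `e_1 ∧ e_3 = e_2 ∧ e_3 = 0`, `e_i = 1`
  have := congrArg (Algebra.TensorProduct.productMap
    (MvPolynomial.aeval fun p : Pairs => if p.1.2 = 1 then (1 : ℂ) else 0)
    (MvPolynomial.aeval fun _ : Fin 3 => (1 : ℂ))) h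
  simp [detVector, wedge] at this

theorem isHighestWeightVector_hwVector {d j : ℕ} (hd : 2 ≤ d) (hj : j ≤ d) :
    IsHighestWeightVector d ![d ^ 2 - j, d, j] (hwVector d j) := by
  have hN : d ≤ d ^ 2 - d := Nat.le_sub_of_add_le (by nlinarith)
  refine ⟨hwVector_mem_targetSpace hd hj, hwVector_ne_zero hd hj, fun i => ?_, fun i k hik => ?_⟩
  · rw [hwVector_eq_mul_pow hd hj]
    have h1 : glAct i i (wedge 0 1 ⊗ₜ[ℂ] (1 : SymV)) =
        (if i = 2 then (0 : ℂ) else 1) • (wedge 0 1 ⊗ₜ[ℂ] (1 : SymV)) := by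
      fin_cases i <;> simp [glAct, glSymV, glSymWedge, wedge]
    have h2 : glAct i i ((1 : SymWedge) ⊗ₜ[ℂ] (MvPolynomial.X 0 : SymV)) =
        (if i = 0 then (1 : ℂ) else 0) • ((1 : SymWedge) ⊗ₜ[ℂ] (MvPolynomial.X 0 : SymV)) := by
      fin_cases i <;> simp [glAct, glSymV, glSymWedge, wedge]
    have h3 : glAct i i detVector = (1 : ℂ) • detVector := by
      fin_cases i <;> simp [glAct, glSymV, glSymWedge, wedge, detVector] <;> abel
    rw [glAct_mul_of_smul (glAct_mul_of_smul (glAct_pow_of_smul h1 _) (glAct_pow_of_smul h2 _))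
      (glAct_pow_of_smul h3 _)]
    congr 1
    have e1 : ((d ^ 2 - j : ℕ) : ℂ) = ((d - j : ℕ) : ℂ) + ((d ^ 2 - d - j : ℕ) : ℂ) + j := by
      exact_mod_cast (by omega : d ^ 2 - j = d - j + (d ^ 2 - d - j) + j)
    have e2 : (d : ℂ) = ((d - j : ℕ) : ℂ) + j := by
      exact_mod_cast (by omega : d = d - j + j)
    fin_cases i
    · simp [e1]
    · simpa using e2.symm
    · simp
  · rw [hwVector_eq_mul_pow hd hj]
    have h1 : glAct i k (wedge 0 1 ⊗ₜ[ℂ] (1 : SymV)) =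
        (0 : ℂ) • (wedge 0 1 ⊗ₜ[ℂ] (1 : SymV)) := by
      fin_cases i <;> fin_cases k <;> simp [glAct, glSymV, glSymWedge, wedge] at hik ⊢
    have h2 : glAct i k ((1 : SymWedge) ⊗ₜ[ℂ] (MvPolynomial.X 0 : SymV)) =
        (0 : ℂ) • ((1 : SymWedge) ⊗ₜ[ℂ] (MvPolynomial.X 0 : SymV)) := by
      fin_cases i <;> fin_cases k <;> simp [glAct, glSymV, glSymWedge, wedge] at hik ⊢
    have h3 : glAct i k detVector = (0 : ℂ) • detVector := by
      fin_cases i <;> fin_cases k <;>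
        simp [glAct, glSymV, glSymWedge, wedge, detVector, TensorProduct.neg_tmul] at hik ⊢
    rw [glAct_mul_of_smul (glAct_mul_of_smul (glAct_pow_of_smul h1 _) (glAct_pow_of_smul h2 _))
      (glAct_pow_of_smul h3 _)]
    simp

/-! ### Words and monomials -/

section Words

variable {ι M : Type*} [AddCommGroup M] [Module ℂ M]

theorem prod_X_eq_monomial {d : ℕ} (w : Fin d → ι) :
    (∏ i, MvPolynomial.X (w i) : MvPolynomial ι ℂ) =
      MvPolynomial.monomial (∑ i, Finsupp.single (w i) 1) 1 :=
  (MvPolynomial.monomial_sum_one _ _).symm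

theorem exists_word {d : ℕ} (a : ι →₀ ℕ) (ha : a.degree = d) :
    ∃ w : Fin d → ι, ∑ i, Finsupp.single (w i) 1 = a := by
  classical
  induction d generalizing a with
  | zero => exact ⟨Fin.elim0, by simpa using ((Finsupp.degree_eq_zero_iff a).1 ha).symm⟩
  | succ d ih =>
    have hne : a ≠ 0 := by
      rintro rfl
      simp at ha
    obtain ⟨i, hi⟩ := Finsupp.ne_iff.1 hne
    have hle : Finsupp.single i 1 ≤ a :=
      Finsupp.single_le_iff.2 (Nat.one_le_iff_ne_zero.2 hi)
    have hdeg := congrArg Finsupp.degree (add_tsub_cancel_of_le hle)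
    rw [map_add, Finsupp.degree_single, ha] at hdeg
    obtain ⟨w, hw⟩ := ih (a - Finsupp.single i 1) (by omega)
    refine ⟨Fin.cons i w, ?_⟩
    rw [Fin.sum_univ_succ]
    simp only [Fin.cons_zero, Fin.cons_succ, hw]
    exact add_tsub_cancel_of_le hle

theorem ofWords_monomial_of_degree_ne (d : ℕ) (F : (Fin d → ι) → M) (a : ι →₀ ℕ)
    (ha : a.degree ≠ d) (c : ℂ) : ofWords d F (MvPolynomial.monomial a c) = 0 := by
  classical
  have h1 : (MvPolynomial.monomial a c : MvPolynomial ι ℂ) =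
      c • MvPolynomial.basisMonomials ι ℂ a := by
    rw [MvPolynomial.coe_basisMonomials, MvPolynomial.smul_monomial, smul_eq_mul, mul_one]
  rw [h1, map_smul, ofWords, Module.Basis.constr_basis, dif_neg, smul_zero]
  rintro ⟨w, rfl⟩
  exact ha (by simp)

end Words

/-! ### The projection onto `S_{(d,d)}V` -/

theorem piDD_prod (d : ℕ) (l m : Fin d → Fin 3) :
    piDD d (∏ i, MvPolynomial.X (l i)) (∏ i, MvPolynomial.X (m i)) =
      ∑ σ : Equiv.Perm (Fin d), ∏ i, wedge (l i) (m (σ i)) := by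
  rw [piDD, ofWords_prod, ofWords_prod]
  · intro m ρ
    exact Fintype.sum_equiv (Equiv.mulLeft ρ) _ _ fun σ => rfl
  · intro l ρ
    congr 1
    funext m
    refine Fintype.sum_equiv (Equiv.mulRight ρ⁻¹) _ _ fun σ => ?_
    rw [← Equiv.prod_comp ρ fun i => wedge (l i) (m ((Equiv.mulRight ρ⁻¹ σ) i))]
    simp

theorem piDD_monomial_of_degree_ne (d : ℕ) (l : Fin d → Fin 3) (a : Fin 3 →₀ ℕ)
    (ha : a.degree ≠ d) (c : ℂ) :
    piDD d (∏ i, MvPolynomial.X (l i)) (MvPolynomial.monomial a c) = 0 := by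
  rw [piDD, ofWords_prod, ofWords_monomial_of_degree_ne _ _ _ ha]
  intro l ρ
  congr 1
  funext m
  refine Fintype.sum_equiv (Equiv.mulRight ρ⁻¹) _ _ fun σ => ?_
  rw [← Equiv.prod_comp ρ fun i => wedge (l i) (m ((Equiv.mulRight ρ⁻¹ σ) i))]
  simp

theorem piDD_monomial_X_pow {d : ℕ} (a : Fin 3 →₀ ℕ) (ha : a.degree = d) (k : Fin 3) :
    piDD d (MvPolynomial.monomial a 1) (MvPolynomial.X k ^ d) =
      (d ! : ℂ) • ∏ i, wedge i k ^ a i := by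
  obtain ⟨w, rfl⟩ := exists_word a ha
  have h := piDD_prod d w fun _ => k
  rw [Finset.prod_const, Finset.card_univ, Fintype.card_fin, prod_X_eq_monomial] at h
  rw [h, Finset.sum_const, Finset.card_univ, Fintype.card_perm, Fintype.card_fin,
    Nat.cast_smul_eq_nsmul]
  congr 1
  simp only [Finsupp.coe_finsetSum, Finset.sum_apply, ← Finset.prod_pow_eq_pow_sum]
  rw [Finset.prod_comm]
  refine Finset.prod_congr rfl fun i _ => ?_
  rw [Finset.prod_eq_single (w i)]
  · simp
  · intro b _ hb
    simp [hb.symm]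
  · simp

/-- The pairing of `e_1^n e_2` with a monomial `e^a`: the factor `e_2` is matched with one
factor of `e^a`, the factors `e_1` with the others. -/
theorem piDD_X_mul_X_pow {n : ℕ} (a : Fin 3 →₀ ℕ) (ha : a.degree = n + 1) :
    piDD (n + 1) (MvPolynomial.X 1 * MvPolynomial.X 0 ^ n) (MvPolynomial.monomial a 1) =
      (n ! : ℂ) • ∑ c, (a c : ℂ) •
        (wedge 1 c * ∏ i, wedge 0 i ^ (a - Finsupp.single c 1 : Fin 3 →₀ ℕ) i) := by
  obtain ⟨m, rfl⟩ := exists_word a ha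
  set a : Fin 3 →₀ ℕ := ∑ i, Finsupp.single (m i) 1 with hadef
  have h := piDD_prod (n + 1) (Fin.cons 1 fun _ => 0) m
  have hl : (∏ i, MvPolynomial.X ((Fin.cons 1 fun _ => 0 : Fin (n + 1) → Fin 3) i) : SymV) =
      MvPolynomial.X 1 * MvPolynomial.X 0 ^ n := by
    rw [Fin.prod_univ_succ]
    simp
  rw [hl, prod_X_eq_monomial, ← Equiv.sum_comp Equiv.Perm.decomposeFin.symm,
    Fintype.sum_prod_type] at h
  rw [h]
  -- the product over the remaining factors does not depend on how they are matched
  have hprod : ∀ (p : Fin (n + 1)) (e : Equiv.Perm (Fin n)),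
      ∏ i : Fin (n + 1), wedge ((Fin.cons 1 fun _ => 0 : Fin (n + 1) → Fin 3) i)
        (m (Equiv.Perm.decomposeFin.symm (p, e) i)) =
      wedge 1 (m p) * ∏ i, wedge 0 i ^ (a - Finsupp.single (m p) 1 : Fin 3 →₀ ℕ) i := by
    intro p e
    rw [Fin.prod_univ_succ]
    simp only [Fin.cons_zero, Fin.cons_succ, Equiv.Perm.decomposeFin_symm_apply_zero,
      Equiv.Perm.decomposeFin_symm_apply_succ]
    congr 1
    rw [Equiv.prod_comp e fun x => wedge 0 (m (Equiv.swap 0 p x.succ))]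
    have hsplit : a - Finsupp.single (m p) 1 =
        ∑ x : Fin n, Finsupp.single (m (Equiv.swap 0 p x.succ)) 1 := by
      have : a = Finsupp.single (m p) 1 +
          ∑ x : Fin n, Finsupp.single (m (Equiv.swap 0 p x.succ)) 1 := by
        rw [hadef, ← Equiv.sum_comp (Equiv.swap 0 p), Fin.sum_univ_succ, Equiv.swap_apply_left]
      rw [this, add_tsub_cancel_left]
    rw [hsplit]
    simp only [Finsupp.coe_finsetSum, Finset.sum_apply, ← Finset.prod_pow_eq_pow_sum]
    rw [Finset.prod_comm]
    refine Finset.prod_congr rfl fun i _ => ?_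
    rw [Finset.prod_eq_single (m (Equiv.swap 0 p i.succ))]
    · simp
    · intro b _ hb
      simp [hb.symm]
    · simp
  simp only [hprod, Finset.sum_const, Finset.card_univ, Fintype.card_perm, Fintype.card_fin]
  rw [← Finset.smul_sum, Nat.cast_smul_eq_nsmul]
  congr 1
  have hcast : ∀ c, (a c : ℂ) = ∑ k, if m k = c then (1 : ℂ) else 0 := by
    intro c
    rw [hadef, Finsupp.finsetSum_apply]
    push_cast
    exact Finset.sum_congr rfl fun k _ => by rw [Finsupp.single_apply]; split_ifs <;> simp
  simp only [hcast, Finset.sum_smul]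
  rw [Finset.sum_comm]
  refine Finset.sum_congr rfl fun k _ => ?_
  simp [ite_smul]

/-- The multi-index of `e_1^a e_2^b e_3^c`. -/
def multiIdx (a b c : ℕ) : Fin 3 →₀ ℕ := Finsupp.equivFunOnFinite.symm ![a, b, c]

@[simp] theorem multiIdx_zero (a b c : ℕ) : multiIdx a b c 0 = a := rfl
@[simp] theorem multiIdx_one (a b c : ℕ) : multiIdx a b c 1 = b := rfl
@[simp] theorem multiIdx_two (a b c : ℕ) : multiIdx a b c 2 = c := rfl

theorem eq_multiIdx (a : Fin 3 →₀ ℕ) : a = multiIdx (a 0) (a 1) (a 2) := by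
  ext i
  fin_cases i <;> rfl

theorem degree_multiIdx (a b c : ℕ) : (multiIdx a b c).degree = a + b + c := by
  rw [Finsupp.degree_eq_sum, Fin.sum_univ_three]
  rfl

/-- `(p ⊗ q) ↦ p_a q`, where `p_a` is the coefficient of the monomial `e^a` in `p`. -/
def coeffLeft (a : Fin 3 →₀ ℕ) : SymV ⊗[ℂ] SymV →ₗ[ℂ] SymV :=
  TensorProduct.lid ℂ SymV ∘ₗ LinearMap.rTensor SymV (MvPolynomial.lcoeff ℂ a)

theorem coeffLeft_tmul (a : Fin 3 →₀ ℕ) (p q : SymV) :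
    coeffLeft a (p ⊗ₜ q) = MvPolynomial.coeff a p • q := rfl

theorem rTensor_eq_sum_coeffLeft {M : Type*} [AddCommGroup M] [Module ℂ M] (L : SymV →ₗ[ℂ] M)
    (S : Finset (Fin 3 →₀ ℕ)) (hS : ∀ a, a ∉ S → L (MvPolynomial.monomial a 1) = 0)
    (r : SymV ⊗[ℂ] SymV) :
    LinearMap.rTensor SymV L r =
      ∑ a ∈ S, L (MvPolynomial.monomial a 1) ⊗ₜ[ℂ] coeffLeft a r := by
  induction r using TensorProduct.induction_on with
  | zero => simp
  | add x y hx hy => simp only [map_add, hx, hy, TensorProduct.tmul_add, Finset.sum_add_distrib]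
  | tmul p q =>
    induction p using MvPolynomial.induction_on' with
    | add p p' h h' =>
      simp only [TensorProduct.add_tmul, map_add, h, h', TensorProduct.tmul_add,
        Finset.sum_add_distrib]
    | monomial b c =>
      have hc : (MvPolynomial.monomial b c : SymV) = c • MvPolynomial.monomial b 1 := by
        rw [MvPolynomial.smul_monomial, smul_eq_mul, mul_one]
      simp only [LinearMap.rTensor_tmul, coeffLeft_tmul, MvPolynomial.coeff_monomial]
      rw [hc, map_smul]
      by_cases hb : b ∈ S
      · rw [Finset.sum_eq_single_of_mem b hb]
        · rw [if_pos rfl, TensorProduct.smul_tmul]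
        · intro a _ ha
          rw [if_neg ha.symm, zero_smul, TensorProduct.tmul_zero]
      · rw [hS b hb, smul_zero, TensorProduct.zero_tmul, Finset.sum_eq_zero]
        intro a ha
        rw [if_neg fun h : b = a => hb (h ▸ ha), zero_smul, TensorProduct.tmul_zero]

/-- The contraction with `e_1^n e_2` only sees the monomials with at most one factor `e_1`. -/
theorem rTensor_piDD_X_mul_X_pow (n : ℕ) (r : SymV ⊗[ℂ] SymV) :
    LinearMap.rTensor SymV (piDD (n + 1) (MvPolynomial.X 1 * MvPolynomial.X 0 ^ n)) r =
      (∑ t ∈ Finset.range (n + 1), (-(n ! : ℂ)) • ((wedge 0 1 ^ (n + 1 - t) * wedge 0 2 ^ t) ⊗ₜ[ℂ]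
          coeffLeft (multiIdx 1 (n - t) t) r)) +
        ∑ t ∈ Finset.range (n + 1), ((n ! : ℂ) * (t + 1)) •
          ((wedge 0 1 ^ (n - t) * wedge 0 2 ^ t * wedge 1 2) ⊗ₜ[ℂ]
            coeffLeft (multiIdx 0 (n - t) (t + 1)) r) := by
  classical
  set L := piDD (n + 1) (MvPolynomial.X 1 * MvPolynomial.X 0 ^ n) with hL
  have w00 : wedge 0 0 = 0 := by simp [wedge]
  have w11 : wedge 1 1 = 0 := by simp [wedge]
  have w10 : wedge 1 0 = -wedge 0 1 := by simp [wedge]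
  have hval : ∀ a : Fin 3 →₀ ℕ, a.degree = n + 1 → L (MvPolynomial.monomial a 1) =
      (n ! : ℂ) • ((a 0 : ℂ) • (-wedge 0 1 * (0 ^ (a 0 - 1) * wedge 0 1 ^ a 1 * wedge 0 2 ^ a 2)) +
        (a 2 : ℂ) • (wedge 1 2 * (0 ^ a 0 * wedge 0 1 ^ a 1 * wedge 0 2 ^ (a 2 - 1)))) := by
    intro a ha
    rw [hL, piDD_X_mul_X_pow a ha, Fin.sum_univ_three]
    simp [Fin.prod_univ_three, w00, w11, w10]
  have h1 : ∀ t ∈ Finset.range (n + 1), L (MvPolynomial.monomial (multiIdx 1 (n - t) t) 1) =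
      (-(n ! : ℂ)) • (wedge 0 1 ^ (n + 1 - t) * wedge 0 2 ^ t) := by
    intro t ht
    rw [Finset.mem_range, Nat.lt_succ_iff] at ht
    rw [hval _ (by rw [degree_multiIdx]; omega), show n + 1 - t = n - t + 1 by omega]
    simp [pow_succ]
    rw [← mul_assoc, mul_comm (wedge 0 1)]
  have h2 : ∀ t ∈ Finset.range (n + 1), L (MvPolynomial.monomial (multiIdx 0 (n - t) (t + 1)) 1) =
      ((n ! : ℂ) * (t + 1)) • (wedge 0 1 ^ (n - t) * wedge 0 2 ^ t * wedge 1 2) := by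
    intro t ht
    rw [Finset.mem_range, Nat.lt_succ_iff] at ht
    rw [hval _ (by rw [degree_multiIdx]; omega)]
    simp [mul_smul]
    congr 2
    ring
  rw [rTensor_eq_sum_coeffLeft L ((Finset.range (n + 1)).image (fun t => multiIdx 1 (n - t) t) ∪
    (Finset.range (n + 1)).image (fun t => multiIdx 0 (n - t) (t + 1))), Finset.sum_union,
    Finset.sum_image, Finset.sum_image]
  · congr 1
    · refine Finset.sum_congr rfl fun t ht => ?_
      rw [h1 t ht, TensorProduct.smul_tmul']
    · refine Finset.sum_congr rfl fun t ht => ?_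
      rw [h2 t ht, TensorProduct.smul_tmul']
  · intro s _ t _ h
    simpa using DFunLike.congr_fun h 2
  · intro s _ t _ h
    simpa using DFunLike.congr_fun h 2
  · rw [Finset.disjoint_left]
    intro a h h'
    obtain ⟨s, -, rfl⟩ := Finset.mem_image.1 h
    obtain ⟨t, -, ht⟩ := Finset.mem_image.1 h'
    simpa using DFunLike.congr_fun ht 0
  · intro a ha
    by_cases hdeg : a.degree = n + 1
    · rw [hval a hdeg]
      rw [eq_multiIdx a, degree_multiIdx] at hdeg
      rw [Finset.mem_union, not_or] at ha
      rcases h0 : a 0 with _ | _ | k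
      · rcases h2' : a 2 with _ | c
        · simp
        · refine absurd (Finset.mem_image.2 ⟨c, by rw [Finset.mem_range]; omega, ?_⟩) ha.2
          rw [eq_multiIdx a, h0, h2', show n - c = a 1 by omega]
      · refine absurd (Finset.mem_image.2 ⟨a 2, by rw [Finset.mem_range]; omega, ?_⟩) ha.1
        rw [show n - a 2 = a 1 by omega, eq_multiIdx a, h0]
        rfl
      · simp
    · have hl : (MvPolynomial.X 1 * MvPolynomial.X 0 ^ n : SymV) =
          ∏ i, MvPolynomial.X ((Fin.cons 1 fun _ => 0 : Fin (n + 1) → Fin 3) i) := by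
        rw [Fin.prod_univ_succ]
        simp
      rw [hL, hl, piDD_monomial_of_degree_ne _ _ _ hdeg]

/-! ### The inner product of two monomials -/

section SymmetricTensors

variable {ι κ : Type*}

/-- The coordinates of the symmetrization of `u_{p 0} ⊗ ⋯ ⊗ u_{p (n-1)}`, where the vector
`u_i` has coordinates `u i x`. -/
def symmCoord (u : ι → κ → ℂ) {n : ℕ} (p : Fin n → ι) (c : Fin n → κ) : ℂ :=
  1 / (n ! : ℂ) * ∑ σ : Equiv.Perm (Fin n), ∏ i, u (p (σ i)) (c i)

theorem symmCoord_comp_perm (u : ι → κ → ℂ) {n : ℕ} (p : Fin n → ι) (ρ : Equiv.Perm (Fin n)) :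
    symmCoord u (fun i => p (ρ i)) = symmCoord u p := by
  funext c
  rw [symmCoord, symmCoord]
  congr 1
  exact Fintype.sum_equiv (Equiv.mulLeft ρ) _ _ fun σ => rfl

/-- If the vectors `u_i` are orthogonal and of the same length, the pairing of two symmetrized
products counts the permutations that take one list of factors to the other. -/
theorem sum_symmCoord_mul [Fintype κ] [DecidableEq ι] (u : ι → κ → ℂ) (γ : ℂ)
    (hu : ∀ i i', ∑ k, u i k * u i' k = if i = i' then γ else 0)
    {n : ℕ} (p p' : Fin n → ι) :
    ∑ c, symmCoord u p c * symmCoord u p' c =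
      γ ^ n / (n ! : ℂ) * (Fintype.card {σ : Equiv.Perm (Fin n) // p ∘ σ = p'} : ℂ) := by
  have hn : (n ! : ℂ) ≠ 0 := by exact_mod_cast Nat.factorial_ne_zero _
  have hprod : ∀ σ τ : Equiv.Perm (Fin n),
      ∑ c : Fin n → κ, (∏ i, u (p (σ i)) (c i)) * ∏ i, u (p' (τ i)) (c i) =
        if p ∘ (σ * τ⁻¹ : Equiv.Perm (Fin n)) = p' then γ ^ n else 0 := by
    intro σ τ
    simp only [← Finset.prod_mul_distrib]
    rw [← Fintype.prod_sum fun i k => u (p (σ i)) k * u (p' (τ i)) k]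
    simp only [hu]
    rw [Finset.prod_ite_zero]
    have hiff : (∀ i ∈ Finset.univ, p (σ i) = p' (τ i)) ↔
        p ∘ (σ * τ⁻¹ : Equiv.Perm (Fin n)) = p' := by
      constructor
      · intro h
        funext i
        simpa using h (τ⁻¹ i) (Finset.mem_univ _)
      · rintro rfl i -
        simp
    rw [Finset.prod_const, Finset.card_univ, Fintype.card_fin]
    split_ifs with h1 h2 h2
    · rfl
    · exact absurd (hiff.1 h1) h2
    · exact absurd (hiff.2 h2) h1
    · rfl
  have hsum : ∑ c, symmCoord u p c * symmCoord u p' c =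
      (1 / (n ! : ℂ)) * (1 / (n ! : ℂ)) *
        ∑ τ : Equiv.Perm (Fin n), ∑ σ : Equiv.Perm (Fin n),
          if p ∘ (σ * τ⁻¹ : Equiv.Perm (Fin n)) = p' then γ ^ n else 0 := by
    simp only [← hprod]
    have hc : ∀ c : Fin n → κ, symmCoord u p c * symmCoord u p' c =
        (1 / (n ! : ℂ)) * (1 / (n ! : ℂ)) * ∑ τ : Equiv.Perm (Fin n), ∑ σ : Equiv.Perm (Fin n),
          (∏ i, u (p (σ i)) (c i)) * ∏ i, u (p' (τ i)) (c i) := by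
      intro c
      rw [symmCoord, symmCoord, mul_mul_mul_comm, Finset.sum_mul_sum, Finset.sum_comm]
    simp only [hc]
    rw [← Finset.mul_sum, Finset.sum_comm]
    congr 1
    exact Finset.sum_congr rfl fun τ _ => Finset.sum_comm
  rw [hsum]
  have hinner : ∀ τ : Equiv.Perm (Fin n), (∑ σ : Equiv.Perm (Fin n),
      if p ∘ (σ * τ⁻¹ : Equiv.Perm (Fin n)) = p' then γ ^ n else 0) =
      (Fintype.card {σ : Equiv.Perm (Fin n) // p ∘ σ = p'} : ℂ) * γ ^ n := by
    intro τ
    refine (Equiv.sum_comp (Equiv.mulRight τ⁻¹)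
      fun σ : Equiv.Perm (Fin n) => if p ∘ σ = p' then γ ^ n else 0).trans ?_
    rw [← Finset.sum_filter, Finset.sum_const, nsmul_eq_mul, Fintype.card_subtype]
  simp only [hinner, Finset.sum_const, Finset.card_univ, Fintype.card_perm, Fintype.card_fin,
    nsmul_eq_mul]
  field_simp

/-- The number of permutations that fix a word is the product of the factorials of the
multiplicities of its letters. -/
theorem card_stabilizer_word [Fintype ι] [DecidableEq ι] {n : ℕ} (p : Fin n → ι) (a : ι →₀ ℕ)
    (hp : ∑ i, Finsupp.single (p i) 1 = a) :
    Fintype.card {σ : Equiv.Perm (Fin n) // p ∘ σ = p} = ∏ i, (a i)! := by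
  rw [DomMulAct.stabilizer_card]
  refine Finset.prod_congr rfl fun i _ => ?_
  rw [← hp, Finsupp.finsetSum_apply, Fintype.card_subtype, Finset.card_filter]
  simp only [Finsupp.single_apply]

end SymmetricTensors

theorem sum_wedgeCoord_mul (p q : Pairs) :
    ∑ z : Fin 3 × Fin 3, wedgeCoord p.1 z.1 z.2 * wedgeCoord q.1 z.1 z.2 =
      if p = q then (1 / 2 : ℂ) else 0 := by
  have hw : ∀ (p : Pairs) (z : Fin 3 × Fin 3), wedgeCoord p.1 z.1 z.2 =
      1 / 2 * ((if z = p.1 then 1 else 0) - if z = p.1.swap then 1 else 0) := fun p z => by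
    simp only [wedgeCoord, Prod.ext_iff, Prod.fst_swap, Prod.snd_swap]
  have hsum : ∀ f : Fin 3 × Fin 3 → ℂ, ∑ z, wedgeCoord p.1 z.1 z.2 * f z =
      1 / 2 * (f p.1 - f p.1.swap) := fun f => by
    simp only [hw, mul_assoc, ← Finset.mul_sum, sub_mul, Finset.sum_sub_distrib, ite_mul, one_mul,
      zero_mul, Finset.sum_ite_eq', Finset.mem_univ, if_true]
  have hne : p.1 ≠ q.1.swap := fun h => by
    have hp := p.2
    rw [h] at hp
    exact lt_asymm hp q.2
  have hne' : p.1.swap ≠ q.1 := fun h => hne (by rw [← h, Prod.swap_swap])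
  rw [hsum, hw, hw, if_neg hne, if_neg hne']
  simp only [Prod.swap_inj, ← Subtype.ext_iff]
  split_ifs <;> norm_num

/-- The coordinates of the basis bivector with index `p` in `V ⊗ V`. -/
def pairCoord (p : Pairs) (z : Fin 3 × Fin 3) : ℂ := wedgeCoord p.1 z.1 z.2

/-- The coordinates of the basis vector with index `q` of `V`. -/
def vecCoord (q x : Fin 3) : ℂ := if x = q then 1 else 0

theorem toTensor_prod_X (d : ℕ) (p : Fin d → Pairs) (q : Fin (d ^ 2 - d) → Fin 3) :
    toTensor d ((∏ i, MvPolynomial.X (p i)) ⊗ₜ[ℂ] (∏ i, MvPolynomial.X (q i))) =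
      WithLp.toLp 2 fun c =>
        symmCoord pairCoord p (fun i => (c (Sum.inl (i, 0)), c (Sum.inl (i, 1)))) *
          symmCoord vecCoord q (fun i => c (Sum.inr i)) := by
  rw [toTensor, TensorProduct.lift.tmul, ofWords_prod, ofWords_prod]
  · rfl
  · intro q ρ
    congr 1
    funext c
    exact congrArg _ (congrFun (symmCoord_comp_perm vecCoord q ρ) fun i => c (Sum.inr i))
  · intro p ρ
    congr 1
    funext q
    congr 1
    funext c
    exact congrArg (· * _) (congrFun (symmCoord_comp_perm pairCoord p ρ)
      fun i => (c (Sum.inl (i, 0)), c (Sum.inl (i, 1))))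

theorem star_symmCoord {ι κ : Type*} (u : ι → κ → ℂ)
    (hu : ∀ i k, (starRingEnd ℂ) (u i k) = u i k) {n : ℕ} (p : Fin n → ι) (c : Fin n → κ) :
    (starRingEnd ℂ) (symmCoord u p c) = symmCoord u p c := by
  simp [symmCoord, map_sum, map_prod, hu]

/-- Monomials in the `e_i ∧ e_k` and the `e_i` are orthogonal, with squared norms given by
factorials. -/
theorem herm_monomial (d : ℕ) (a a' : Pairs →₀ ℕ) (b b' : Fin 3 →₀ ℕ) (ha : a.degree = d)
    (ha' : a'.degree = d) (hb : b.degree = d ^ 2 - d) (hb' : b'.degree = d ^ 2 - d) :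
    herm d (MvPolynomial.monomial a 1 ⊗ₜ MvPolynomial.monomial b 1)
        (MvPolynomial.monomial a' 1 ⊗ₜ MvPolynomial.monomial b' 1) =
      if a = a' ∧ b = b' then
        (1 / 2 : ℂ) ^ d / ((d ! : ℂ) * ((d ^ 2 - d)! : ℂ)) *
          ((∏ i, ((a i)! : ℂ)) * ∏ i, ((b i)! : ℂ))
      else 0 := by
  have key : ∀ (p p' : Fin d → Pairs) (q q' : Fin (d ^ 2 - d) → Fin 3),
      herm d ((∏ i, MvPolynomial.X (p i)) ⊗ₜ[ℂ] (∏ i, MvPolynomial.X (q i)))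
        ((∏ i, MvPolynomial.X (p' i)) ⊗ₜ[ℂ] (∏ i, MvPolynomial.X (q' i))) =
      ((1 / 2 : ℂ) ^ d / (d ! : ℂ) * (Fintype.card {σ : Equiv.Perm (Fin d) // p ∘ σ = p'} : ℂ)) *
        (1 ^ (d ^ 2 - d) / ((d ^ 2 - d)! : ℂ) *
          (Fintype.card {σ : Equiv.Perm (Fin (d ^ 2 - d)) // q ∘ σ = q'} : ℂ)) := by
    intro p p' q q'
    rw [herm, toTensor_prod_X, toTensor_prod_X, PiLp.inner_apply,
      ← sum_symmCoord_mul pairCoord (1 / 2) sum_wedgeCoord_mul,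
      ← sum_symmCoord_mul vecCoord 1 (by simp [vecCoord, eq_comm]), Finset.sum_mul_sum,
      ← Fintype.sum_prod_type']
    refine Fintype.sum_equiv ((Equiv.sumArrowEquivProdArrow _ _ _).trans (Equiv.prodCongr
      ((Equiv.curry _ _ _).trans (Equiv.arrowCongr (Equiv.refl _) (finTwoArrowEquiv _)))
      (Equiv.refl _))) _ _ fun c => ?_
    rw [RCLike.inner_apply, map_mul, star_symmCoord, star_symmCoord]
    · simp only [Equiv.trans_apply, Equiv.prodCongr_apply, Prod.map_fst, Prod.map_snd,
        Equiv.refl_apply]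
      change _ = symmCoord pairCoord p (fun i => (c (Sum.inl (i, 0)), c (Sum.inl (i, 1)))) *
        symmCoord pairCoord p' (fun i => (c (Sum.inl (i, 0)), c (Sum.inl (i, 1)))) *
        (symmCoord vecCoord q (fun i => c (Sum.inr i)) *
          symmCoord vecCoord q' (fun i => c (Sum.inr i)))
      ring
    · intro i k
      simp only [vecCoord]
      split_ifs <;> simp
    · intro i k
      simp only [pairCoord, wedgeCoord]
      split_ifs <;> simp [Complex.conj_ofNat]
  have hempty : ∀ {ι : Type} {n : ℕ} (p p' : Fin n → ι),
      (∑ i, Finsupp.single (p i) 1 : ι →₀ ℕ) ≠ ∑ i, Finsupp.single (p' i) 1 →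
        IsEmpty {σ : Equiv.Perm (Fin n) // p ∘ σ = p'} := by
    intro ι n p p' h
    refine ⟨fun σ => h ?_⟩
    obtain ⟨σ, rfl⟩ := σ
    exact (Equiv.sum_comp σ fun i => Finsupp.single (p i) 1).symm
  obtain ⟨p, hp⟩ := exists_word a ha
  obtain ⟨q, hq⟩ := exists_word b hb
  split_ifs with h
  · obtain ⟨rfl, rfl⟩ := h
    have := key p p q q
    rw [prod_X_eq_monomial, prod_X_eq_monomial, card_stabilizer_word p a hp,
      card_stabilizer_word q b hq, hp, hq] at this
    rw [this]
    push_cast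
    rw [one_pow]
    ring
  · obtain ⟨p', hp'⟩ := exists_word a' ha'
    obtain ⟨q', hq'⟩ := exists_word b' hb'
    have := key p p' q q'
    rw [prod_X_eq_monomial, prod_X_eq_monomial, prod_X_eq_monomial, prod_X_eq_monomial, hp, hq,
      hp', hq'] at this
    rw [this]
    rcases not_and_or.1 h with h | h
    · have := hempty p p' (by rwa [hp, hp'])
      simp
    · have := hempty q q' (by rwa [hq, hq'])
      simp

/-! ### Brill's map along a line -/

theorem polar_add_smul (k : ℕ) (g h : SymV) (c : ℂ) :
    polar k (g + c • h) = polar k g + c • polar k h := by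
  simp only [polar, map_add, map_smul]

theorem brillQ_smul (d : ℕ) (c : ℂ) (f : SymV) : brillQ d (c • f) = c ^ d • brillQ d f := by
  have h : ∀ k : Fin d, brillE ((k : ℕ) + 1) (c • f) =
      algebraMap ℂ (SymV ⊗[ℂ] SymV) c ^ ((k : ℕ) + 1) * brillE ((k : ℕ) + 1) f := by
    intro k
    rw [brillE, brillE, Nat.add_sub_cancel, TensorProduct.tmul_smul, smul_pow, polar, polar,
      map_smul, map_smul, smul_mul_assoc, mul_smul_comm, smul_smul, ← map_pow,
      ← Algebra.smul_def, ← pow_succ']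
  rw [brillQ, funext h, girard_pow_mul, ← map_pow, ← Algebra.smul_def, brillQ]

/-- The polynomial `Q_d(g + ε h)` in the parameter `ε`. -/
def brillQLine (d : ℕ) (g h : SymV) : Polynomial (SymV ⊗[ℂ] SymV) :=
  girard d fun k =>
    (Polynomial.C (polar ((k : ℕ) + 1) g) + Polynomial.X * Polynomial.C (polar ((k : ℕ) + 1) h)) *
      (Polynomial.C (1 ⊗ₜ g) + Polynomial.X * Polynomial.C (1 ⊗ₜ h)) ^ (k : ℕ)

theorem natDegree_C_add_X_mul_C_le {A : Type*} [CommRing A] (a b : A) :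
    (Polynomial.C a + Polynomial.X * Polynomial.C b).natDegree ≤ 1 := by
  rw [add_comm, mul_comm]
  exact Polynomial.natDegree_linear_le

theorem natDegree_line_le {A : Type*} [CommRing A] (a b a' b' : A) (k : ℕ) :
    ((Polynomial.C a + Polynomial.X * Polynomial.C b) *
      (Polynomial.C a' + Polynomial.X * Polynomial.C b') ^ k).natDegree ≤ k + 1 := by
  refine Polynomial.natDegree_mul_le.trans ?_
  have h1 := natDegree_C_add_X_mul_C_le a b
  have h2 := Polynomial.natDegree_pow_le_of_le k (natDegree_C_add_X_mul_C_le a' b')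
  omega

theorem natDegree_brillQLine_le (d : ℕ) (g h : SymV) : (brillQLine d g h).natDegree ≤ d :=
  natDegree_girard_le _ _ fun _ => natDegree_line_le _ _ _ _ _

theorem coeff_brillQLine_self (d : ℕ) (g h : SymV) : (brillQLine d g h).coeff d = brillQ d h := by
  rw [brillQLine, coeff_girard _ _ fun _ => natDegree_line_le _ _ _ _ _, brillQ]
  congr 1
  funext k
  rw [add_comm (k : ℕ) 1, Polynomial.coeff_mul_add_eq_of_natDegree_le
    (natDegree_C_add_X_mul_C_le _ _)]
  · have := Polynomial.coeff_pow_of_natDegree_le (m := (k : ℕ))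
      (natDegree_C_add_X_mul_C_le ((1 : SymV) ⊗ₜ[ℂ] g) ((1 : SymV) ⊗ₜ[ℂ] h))
    rw [mul_one] at this
    rw [this, brillE, Nat.add_sub_cancel_left]
    simp [Polynomial.coeff_C]
  · simpa using Polynomial.natDegree_pow_le_of_le (k : ℕ) (natDegree_C_add_X_mul_C_le _ _)

theorem aeval_brillQLine (d : ℕ) (g h : SymV) (c : ℂ) :
    ((Polynomial.aeval (algebraMap ℂ (SymV ⊗[ℂ] SymV) c)).restrictScalars ℂ :
      Polynomial (SymV ⊗[ℂ] SymV) →ₐ[ℂ] SymV ⊗[ℂ] SymV) (brillQLine d g h) =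
      brillQ d (g + c • h) := by
  refine (map_girard (A := Polynomial (SymV ⊗[ℂ] SymV)) (B := SymV ⊗[ℂ] SymV)
    ((Polynomial.aeval (algebraMap ℂ (SymV ⊗[ℂ] SymV) c)).restrictScalars ℂ :
      Polynomial (SymV ⊗[ℂ] SymV) →ₐ[ℂ] SymV ⊗[ℂ] SymV) d _).trans
    (congrArg (girard d) (funext fun k => ?_))
  rw [brillE, polar_add_smul, Nat.add_sub_cancel, TensorProduct.tmul_add, TensorProduct.tmul_smul]
  have hs : ∀ x : SymV ⊗[ℂ] SymV, c • x = algebraMap ℂ (SymV ⊗[ℂ] SymV) c * x :=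
    fun x => Algebra.smul_def c x
  rw [hs, hs]
  simp only [AlgHom.restrictScalars_apply, map_mul, map_add, map_pow, Polynomial.aeval_X,
    Polynomial.aeval_C, Algebra.algebraMap_self, RingHom.id_apply]

/-- `Q_d(a g + b h)` is a binary form in `a` and `b` of degree `d`. -/
theorem brillQ_add_smul (d : ℕ) (g h : SymV) (a b : ℂ) :
    brillQ d (a • g + b • h) =
      ∑ i ∈ Finset.range (d + 1), (a ^ (d - i) * b ^ i) • (brillQLine d g h).coeff i := by
  by_cases ha : a = 0
  · subst ha
    rw [zero_smul, zero_add, brillQ_smul, Finset.sum_range_succ, Finset.sum_eq_zero,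
      coeff_brillQLine_self]
    · simp
    · intro i hi
      rw [Finset.mem_range] at hi
      rw [zero_pow (by omega), zero_mul, zero_smul]
  · have h1 : a • g + b • h = a • (g + (b / a) • h) := by
      rw [smul_add, smul_smul, mul_div_cancel₀ _ ha]
    rw [h1, brillQ_smul, ← aeval_brillQLine, AlgHom.restrictScalars_apply,
      Polynomial.aeval_eq_sum_range' (Nat.lt_succ_of_le (natDegree_brillQLine_le d g h)),
      Finset.smul_sum]
    refine Finset.sum_congr rfl fun i hi => ?_
    rw [Finset.mem_range, Nat.lt_succ_iff] at hi
    rw [← map_pow, smul_eq_mul, mul_comm, ← Algebra.smul_def, smul_smul]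
    congr 1
    rw [div_pow, ← Nat.sub_add_cancel hi, pow_add, Nat.add_sub_cancel]
    field_simp

/-- The coefficients of `𝔅(g + ε h)` in the parameter `ε`, by the product rule for `f ⊗ Q_d(f)`. -/
def brillPolyLine (d : ℕ) (g h : SymV) : ℕ → SymWedge ⊗[ℂ] SymV
  | 0 => LinearMap.rTensor SymV (piDD d g) ((brillQLine d g h).coeff 0)
  | i + 1 => LinearMap.rTensor SymV (piDD d g) ((brillQLine d g h).coeff (i + 1)) +
      LinearMap.rTensor SymV (piDD d h) ((brillQLine d g h).coeff i)

theorem brillPoly_add_smul (d : ℕ) (g h : SymV) (a b : ℂ) :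
    brillPoly d (a • g + b • h) =
      ∑ i ∈ Finset.range (d + 2), (a ^ (d + 1 - i) * b ^ i) • brillPolyLine d g h i := by
  have hL : LinearMap.rTensor SymV (piDD d (a • g + b • h)) =
      a • LinearMap.rTensor SymV (piDD d g) + b • LinearMap.rTensor SymV (piDD d h) := by
    rw [map_add, map_smul, map_smul, LinearMap.rTensor_add, LinearMap.rTensor_smul,
      LinearMap.rTensor_smul]
  have htop : (brillQLine d g h).coeff (d + 1) = 0 :=
    Polynomial.coeff_eq_zero_of_natDegree_lt (Nat.lt_succ_of_le (natDegree_brillQLine_le d g h))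
  rw [brillPoly, hL, brillQ_add_smul, LinearMap.add_apply, LinearMap.smul_apply,
    LinearMap.smul_apply, map_sum, map_sum, Finset.smul_sum, Finset.smul_sum,
    Finset.sum_range_succ' _ (d + 1)]
  simp only [brillPolyLine, smul_add, Finset.sum_add_distrib]
  rw [add_right_comm]
  congr 1
  · rw [← Finset.sum_range_succ' (fun i => (a ^ (d + 1 - i) * b ^ i) •
      LinearMap.rTensor SymV (piDD d g) ((brillQLine d g h).coeff i)) (d + 1),
      Finset.sum_range_succ _ (d + 1), htop, map_zero, smul_zero, add_zero]
    refine Finset.sum_congr rfl fun i hi => ?_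
    rw [Finset.mem_range, Nat.lt_succ_iff] at hi
    rw [map_smul, smul_smul, Nat.succ_sub hi, pow_succ', mul_assoc]
  · refine Finset.sum_congr rfl fun i hi => ?_
    rw [map_smul, smul_smul, Nat.add_sub_add_right]
    ring_nf

/-- The value of Brill's map on `v_j` is a first-order variation of Brill's polynomial map. -/
theorem brillMap_testVector (d j : ℕ) (hd : 1 ≤ d) (hj : j ≤ d) :
    brillMap d (testVector d j hd hj) = (1 / ((d : ℂ) + 1)) •
      brillPolyLine d (MvPolynomial.monomial (monoIdx d 1 hd 1).1 1)
        (MvPolynomial.monomial (monoIdx d j hj 2).1 1) 1 := by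
  have hv : testVector d j hd hj = ∏ i, MvPolynomial.X
      ((Fin.cons (monoIdx d j hj 2) fun _ => monoIdx d 1 hd 1 : Fin (d + 1) → MonoIdx d) i) := by
    rw [Fin.prod_univ_succ, testVector, mul_comm]
    simp
  rw [hv, brillMap, ofWords_prod]
  · rw [← polarization_cons_const d (brillPoly d) _ _ _ (brillPoly_add_smul d _ _)]
    congr 1
    funext i
    refine Fin.cases rfl (fun i => rfl) i
  · intro w σ
    exact polarization_comp_perm _ _ (fun i => MvPolynomial.monomial (w i).1 1) σ

/-! ### First-order variation of Girard's formula -/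

section DualNumbers

open PowerSeries

variable {S : Type*} [CommRing S] [Algebra ℂ S]

/-- Girard's polynomial for `E = N(T N_0) / N_0`, where `N = G + ε H` has coefficients in the
dual numbers. The `ε`-part is computed from `N'/N = G'/G + ε (H/G)'`. -/
theorem girard_dualNumber {d : ℕ} (hd : 1 ≤ d) (G H I : S⟦X⟧) (hI : G * I = 1)
    (hG : ∀ k, d < k → coeff k G = 0) (hH : ∀ k, d < k → coeff k H = 0) :
    girard d (fun k : Fin d =>
      (TrivSqZeroExt.inl (coeff ((k : ℕ) + 1) G) + TrivSqZeroExt.inr (coeff ((k : ℕ) + 1) H)) *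
        (TrivSqZeroExt.inl (coeff 0 G) + TrivSqZeroExt.inr (coeff 0 H) : DualNumber S) ^ (k : ℕ)) =
      TrivSqZeroExt.inl ((-1) ^ (d - 1) * (coeff 0 G ^ d * coeff (d - 1) (derivative S G * I))) +
      TrivSqZeroExt.inr ((-1) ^ (d - 1) * (coeff 0 G ^ d * (d * coeff d (H * I)) +
        d * coeff 0 G ^ (d - 1) * coeff 0 H * coeff (d - 1) (derivative S G * I))) := by
  obtain ⟨n, rfl⟩ : ∃ n, d = n + 1 := ⟨d - 1, by omega⟩
  set ι : S →+* DualNumber S := TrivSqZeroExt.inlHom S S with hι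
  have hmap : ∀ F : S⟦X⟧, derivative (DualNumber S) (map ι F) = map ι (derivative S F) := by
    intro F
    ext k : 1
    simp only [coeff_derivative, coeff_map, map_mul, map_add, map_natCast, map_one]
  set e : (DualNumber S)⟦X⟧ := C DualNumber.eps with he
  have hee : e * e = 0 := by rw [he, ← map_mul, DualNumber.eps_mul_eps, map_zero]
  set N : (DualNumber S)⟦X⟧ := map ι G + e * map ι H with hN
  have hcoeff : ∀ (F F' : S⟦X⟧) k, coeff k (map ι F + e * map ι F') =
      TrivSqZeroExt.inl (coeff k F) + TrivSqZeroExt.inr (coeff k F') := by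
    intro F F' k
    rw [map_add, he, coeff_C_mul, coeff_map, coeff_map, hι, TrivSqZeroExt.inlHom_apply,
      TrivSqZeroExt.inlHom_apply, DualNumber.inr_eq_smul_eps, mul_comm]
    congr 1
    ext <;> simp
  have hGI : map ι G * map ι I = 1 := by rw [← map_mul, hI, map_one]
  -- the inverse of `G + ε H` is `I - ε H I²`
  have hJ : N * (map ι I - e * map ι (H * I ^ 2)) = 1 := by
    simp only [hN, map_mul, map_pow]
    linear_combination (1 - e * map ι H * map ι I) * hGI - map ι H ^ 2 * map ι I ^ 2 * hee
  have h1 := girard_coeff_mul_pow hd N _ hJ fun k hk => by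
    rw [hN, hcoeff, hG k hk, hH k hk]
    simp
  -- `N'/N = G'/G + ε (H/G)'`
  have h2 : derivative (DualNumber S) N * (map ι I - e * map ι (H * I ^ 2)) =
      map ι (derivative S G * I) + e * map ι (derivative S (H * I)) := by
    have hDI : derivative S G * I + G * derivative S I = 0 := by
      have := congrArg (derivative S) hI
      rw [Derivation.leibniz, Derivation.map_one_eq_zero, smul_eq_mul, smul_eq_mul] at this
      linear_combination this
    have hDI' : derivative S I = -(derivative S G * I ^ 2) := by
      linear_combination I * hDI - derivative S I * hI
    have hDe : derivative (DualNumber S) e = 0 := derivative_C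
    have hDHI : derivative S (H * I) = derivative S H * I - H * (derivative S G * I ^ 2) := by
      rw [Derivation.leibniz, smul_eq_mul, smul_eq_mul, hDI']
      ring
    rw [hDHI]
    simp only [hN, map_add, Derivation.leibniz, hmap, hDe, smul_eq_mul, map_mul, map_pow, map_sub]
    linear_combination (-map ι (derivative S H) * map ι H * map ι I ^ 2) * hee
  rw [h2] at h1
  simp only [hN, hcoeff] at h1
  rw [h1, coeff_derivative]
  ext
  · simp [TrivSqZeroExt.fst_pow]
  · simp [TrivSqZeroExt.fst_pow, TrivSqZeroExt.snd_pow]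
    ring

end DualNumbers

/-! ### Tensors as polynomials with rational function coefficients -/

/-- The field of rational functions on `V^*`. -/
abbrev RatV : Type := FractionRing SymV

/-- `S^•V ⊗ S^•V`, as polynomials in the variables `x_i = e_i ⊗ 1` whose coefficients are
polynomials in the variables `y_i = 1 ⊗ e_i`, the latter embedded into rational functions. -/
def toPoly : SymV ⊗[ℂ] SymV →ₐ[ℂ] MvPolynomial (Fin 3) RatV :=
  Algebra.TensorProduct.productMap (MvPolynomial.aeval MvPolynomial.X)
    (IsScalarTower.toAlgHom ℂ SymV (MvPolynomial (Fin 3) RatV))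

theorem toPoly_tmul (p q : SymV) :
    toPoly (p ⊗ₜ q) = MvPolynomial.aeval MvPolynomial.X p *
      MvPolynomial.C (algebraMap SymV RatV q) := by
  rw [toPoly, Algebra.TensorProduct.productMap_apply_tmul]
  rfl

theorem aeval_X_monomial (a : Fin 3 →₀ ℕ) (c : ℂ) :
    (MvPolynomial.aeval MvPolynomial.X (MvPolynomial.monomial a c) : MvPolynomial (Fin 3) RatV) =
      MvPolynomial.monomial a (algebraMap ℂ RatV c) := by
  rw [MvPolynomial.aeval_monomial, MvPolynomial.monomial_eq]
  rfl

/-- The field of rational functions contains `S^•V`, so that an identity between the coefficients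
of `toPoly r` is one between those of `r`. -/
theorem coeff_toPoly (a : Fin 3 →₀ ℕ) (r : SymV ⊗[ℂ] SymV) :
    MvPolynomial.coeff a (toPoly r) = algebraMap SymV RatV (coeffLeft a r) := by
  induction r using TensorProduct.induction_on with
  | zero => simp
  | add x y hx hy => simp only [map_add, MvPolynomial.coeff_add, hx, hy]
  | tmul p q =>
    rw [toPoly_tmul, coeffLeft_tmul, mul_comm, MvPolynomial.coeff_C_mul]
    induction p using MvPolynomial.induction_on' with
    | add p p' h h' =>
      rw [map_add, MvPolynomial.coeff_add, mul_add, h, h', MvPolynomial.coeff_add, add_smul,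
        map_add]
    | monomial b c =>
      rw [aeval_X_monomial, MvPolynomial.coeff_monomial, MvPolynomial.coeff_monomial]
      split_ifs
      · rw [Algebra.smul_def, map_mul, mul_comm, ← IsScalarTower.algebraMap_apply]
      · simp

theorem coeffLeft_eq_of_coeff_toPoly {a : Fin 3 →₀ ℕ} {r : SymV ⊗[ℂ] SymV} {q : SymV}
    (h : MvPolynomial.coeff a (toPoly r) = algebraMap SymV RatV q) : coeffLeft a r = q :=
  IsFractionRing.injective SymV RatV ((coeff_toPoly a r).symm.trans h)

theorem coeffLeft_eq_of_toPoly_eq {r r' : SymV ⊗[ℂ] SymV} (h : toPoly r = toPoly r')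
    (a : Fin 3 →₀ ℕ) : coeffLeft a r = coeffLeft a r' :=
  coeffLeft_eq_of_coeff_toPoly (by rw [h, coeff_toPoly])

section TaylorExpansion

open PowerSeries

/-- The variable `y_i`, as a rational function. -/
def ratVar (i : Fin 3) : RatV := algebraMap SymV RatV (MvPolynomial.X i)

theorem ratVar_ne_zero (i : Fin 3) : ratVar i ≠ 0 := by
  rw [ratVar, Ne, IsFractionRing.to_map_eq_zero_iff]
  exact MvPolynomial.X_ne_zero i

theorem aeval_map_ratVar {B : Type*} [CommRing B] [Algebra ℂ B] (F : RatV →+* B)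
    (hF : ∀ c, F (algebraMap ℂ RatV c) = algebraMap ℂ B c) (q : SymV) :
    MvPolynomial.aeval (fun i => F (ratVar i)) q = F (algebraMap SymV RatV q) := by
  induction q using MvPolynomial.induction_on with
  | C c =>
    rw [MvPolynomial.aeval_C, ← hF, IsScalarTower.algebraMap_apply ℂ SymV RatV]
    rfl
  | add p q hp hq => rw [map_add, map_add, map_add, hp, hq]
  | mul_X p i hp => rw [map_mul, map_mul, map_mul, hp, MvPolynomial.aeval_X, ratVar]

theorem C_algebraMap_ratV (c : ℂ) :
    (C (MvPolynomial.C (algebraMap ℂ RatV c)) : (MvPolynomial (Fin 3) RatV)⟦X⟧) =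
      algebraMap ℂ _ c := by
  rw [PowerSeries.algebraMap_apply, MvPolynomial.algebraMap_apply]

/-- The Taylor expansion `f ↦ f(y + T x)`, as a power series in `T`. -/
def taylor : SymV →ₐ[ℂ] (MvPolynomial (Fin 3) RatV)⟦X⟧ :=
  MvPolynomial.aeval fun i => C (MvPolynomial.C (ratVar i)) + X * C (MvPolynomial.X i)

/-- The map `p ⊗ q ↦ p(T x) q(y)`. -/
def scaleLeft : SymV ⊗[ℂ] SymV →ₐ[ℂ] (MvPolynomial (Fin 3) RatV)⟦X⟧ :=
  Algebra.TensorProduct.productMap (MvPolynomial.aeval fun i => X * C (MvPolynomial.X i))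
    (MvPolynomial.aeval fun i => C (MvPolynomial.C (ratVar i)))

theorem scaleLeft_comul (f : SymV) : scaleLeft (comul f) = taylor f := by
  have h : scaleLeft.comp comul = taylor := by
    refine MvPolynomial.algHom_ext fun i => ?_
    simp [scaleLeft, comul, taylor, add_comm]
  exact DFunLike.congr_fun h f

theorem coeff_scaleLeft (k : ℕ) (r : SymV ⊗[ℂ] SymV) :
    coeff k (scaleLeft r) =
      toPoly (LinearMap.rTensor SymV (MvPolynomial.homogeneousComponent k) r) := by
  induction r using TensorProduct.induction_on with
  | zero => simp
  | add x y hx hy => simp only [map_add, hx, hy]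
  | tmul p q =>
    have hq : (MvPolynomial.aeval (fun i => C (MvPolynomial.C (ratVar i))) q :
        (MvPolynomial (Fin 3) RatV)⟦X⟧) = C (MvPolynomial.C (algebraMap SymV RatV q)) := by
      exact aeval_map_ratVar (C.comp MvPolynomial.C) C_algebraMap_ratV q
    rw [scaleLeft, Algebra.TensorProduct.productMap_apply_tmul, hq, LinearMap.rTensor_tmul,
      toPoly_tmul, mul_comm, coeff_C_mul, mul_comm]
    congr 1
    induction p using MvPolynomial.induction_on' with
    | add p p' h h' => simp only [map_add, h, h']
    | monomial b c =>
      have hX : (MvPolynomial.aeval (fun i => X * C (MvPolynomial.X i))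
          (MvPolynomial.monomial b c) : (MvPolynomial (Fin 3) RatV)⟦X⟧) =
          C (MvPolynomial.monomial b (algebraMap ℂ RatV c)) * X ^ b.degree := by
        rw [MvPolynomial.aeval_monomial, MvPolynomial.monomial_eq, PowerSeries.algebraMap_apply,
          MvPolynomial.algebraMap_apply, Finsupp.prod, Finsupp.prod, map_mul, map_prod]
        simp only [mul_pow, Finset.prod_mul_distrib, Finset.prod_pow_eq_pow_sum, map_pow]
        rw [Finsupp.degree_apply]
        ring
      rw [hX, coeff_C_mul, coeff_X_pow, MvPolynomial.homogeneousComponent_of_mem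
        (MvPolynomial.isHomogeneous_monomial c rfl)]
      split_ifs
      · rw [mul_one, aeval_X_monomial]
      · rw [mul_zero, map_zero]

/-- The polarizations of `f` are the coefficients of its Taylor expansion. -/
theorem coeff_taylor (k : ℕ) (f : SymV) : coeff k (taylor f) = toPoly (polar k f) := by
  rw [← scaleLeft_comul, coeff_scaleLeft, polar]

end TaylorExpansion

/-! ### The first-order variation of `Q_d` along a line, through Taylor series -/

section Variation

open PowerSeries

theorem coeff_zero_taylor (f : SymV) :
    coeff 0 (taylor f) = MvPolynomial.C (algebraMap SymV RatV f) := by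
  rw [coeff_zero_eq_constantCoeff]
  induction f using MvPolynomial.induction_on with
  | C c =>
    rw [taylor, MvPolynomial.aeval_C, ← C_algebraMap_ratV, constantCoeff_C,
      IsScalarTower.algebraMap_apply ℂ SymV RatV]
    rfl
  | add p q hp hq => simp only [map_add, hp, hq]
  | mul_X p i hp =>
    rw [map_mul, map_mul, map_mul, map_mul, hp, ← ratVar]
    simp [taylor]

theorem toPoly_one_tmul (f : SymV) : toPoly (1 ⊗ₜ f) = coeff 0 (taylor f) := by
  rw [toPoly_tmul, map_one, one_mul, coeff_zero_taylor]

section DualReduction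

theorem eps_mul_inl {S : Type*} [CommRing S] (s : S) :
    (DualNumber.eps * TrivSqZeroExt.inl s : DualNumber S) = TrivSqZeroExt.inr s := by
  ext <;> simp

variable {R S : Type*} [CommRing R] [Algebra ℂ R] [CommRing S] [Algebra ℂ S]

/-- The reduction `p ↦ p(0) + ε p'(0)` of a polynomial in `ε` to the dual numbers, along a change
of coefficients. -/
def toDual (F : R →ₐ[ℂ] S) : Polynomial R →ₐ[ℂ] DualNumber S :=
  Polynomial.eval₂AlgHom ((TrivSqZeroExt.inlAlgHom ℂ S S).comp F) DualNumber.eps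
    fun _ => Commute.all _ _

theorem toDual_C (F : R →ₐ[ℂ] S) (r : R) :
    toDual F (Polynomial.C r) = TrivSqZeroExt.inl (F r) := by
  simp [toDual]

theorem toDual_X (F : R →ₐ[ℂ] S) : toDual F Polynomial.X = DualNumber.eps := by
  simp [toDual]

theorem toDual_eq (F : R →ₐ[ℂ] S) (p : Polynomial R) :
    toDual F p = TrivSqZeroExt.inl (F (p.coeff 0)) + TrivSqZeroExt.inr (F (p.coeff 1)) := by
  induction p using Polynomial.induction_on' with
  | add p q hp hq =>
    rw [map_add, hp, hq, Polynomial.coeff_add, Polynomial.coeff_add, map_add, map_add,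
      TrivSqZeroExt.inl_add, TrivSqZeroExt.inr_add]
    abel
  | monomial n a =>
    rw [← Polynomial.C_mul_X_pow_eq_monomial, map_mul, map_pow, toDual_C, toDual_X]
    rcases n with _ | _ | n
    · simp [Polynomial.coeff_C]
    · rw [zero_add, pow_one, mul_comm, eps_mul_inl]
      simp
    · have : (DualNumber.eps ^ (n + 1 + 1) : DualNumber S) = 0 := by
        rw [pow_succ, pow_succ, mul_assoc, DualNumber.eps_mul_eps, mul_zero]
      rw [this]
      simp [Polynomial.coeff_X_pow]

/-- The terms of order at most one of Girard's polynomial along a line `a + ε b`, computed after a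
change of coefficients `F` that turns `a` and `b` into the coefficients of power series `G` and
`H`. -/
theorem map_coeff_girard_line (F : R →ₐ[ℂ] S) {d : ℕ} (hd : 1 ≤ d) (a b : ℕ → R) (a₀ b₀ : R)
    (G H I : S⟦X⟧) (hI : G * I = 1) (hG : ∀ k, d < k → coeff k G = 0)
    (hH : ∀ k, d < k → coeff k H = 0) (ha : ∀ k, F (a k) = coeff k G)
    (hb : ∀ k, F (b k) = coeff k H) (ha₀ : F a₀ = coeff 0 G) (hb₀ : F b₀ = coeff 0 H)
    (p : Polynomial R) (hp : p = girard d fun k =>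
      (Polynomial.C (a ((k : ℕ) + 1)) + Polynomial.X * Polynomial.C (b ((k : ℕ) + 1))) *
        (Polynomial.C a₀ + Polynomial.X * Polynomial.C b₀) ^ (k : ℕ)) :
    F (p.coeff 0) = (-1) ^ (d - 1) * (coeff 0 G ^ d * coeff (d - 1) (derivative S G * I)) ∧
    F (p.coeff 1) =
      (-1) ^ (d - 1) * (coeff 0 G ^ d * (d * coeff d (H * I)) +
        d * coeff 0 G ^ (d - 1) * coeff 0 H * coeff (d - 1) (derivative S G * I)) := by
  have h1 := girard_dualNumber hd G H I hI hG hH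
  have h2 := congrArg (toDual F) hp
  rw [map_girard] at h2
  simp only [map_mul, map_add, map_pow, toDual_C, toDual_X, eps_mul_inl, ha, hb, ha₀, hb₀] at h2
  rw [h1, toDual_eq] at h2
  constructor
  · simpa using congrArg TrivSqZeroExt.fst h2
  · simpa using congrArg TrivSqZeroExt.snd h2

end DualReduction

/-- The terms of order at most one of `Q_d(g + ε h)`, in terms of the Taylor expansions of `g` and
`h`. -/
theorem toPoly_coeff_brillQLine {d : ℕ} (hd : 1 ≤ d) (g h : SymV)
    (I : (MvPolynomial (Fin 3) RatV)⟦X⟧) (hI : taylor g * I = 1)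
    (hg : ∀ k, d < k → coeff k (taylor g) = 0) (hh : ∀ k, d < k → coeff k (taylor h) = 0) :
    toPoly ((brillQLine d g h).coeff 0) = (-1) ^ (d - 1) * (coeff 0 (taylor g) ^ d *
      coeff (d - 1) (derivative _ (taylor g) * I)) ∧
    toPoly ((brillQLine d g h).coeff 1) =
      (-1) ^ (d - 1) * (coeff 0 (taylor g) ^ d * (d * coeff d (taylor h * I)) +
        d * coeff 0 (taylor g) ^ (d - 1) * coeff 0 (taylor h) *
          coeff (d - 1) (derivative _ (taylor g) * I)) :=
  map_coeff_girard_line toPoly hd (fun k => polar k g) (fun k => polar k h) (1 ⊗ₜ g)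
    (1 ⊗ₜ h) _ _ I hI hg hh (fun k => (coeff_taylor k g).symm) (fun k => (coeff_taylor k h).symm)
    (toPoly_one_tmul g) (toPoly_one_tmul h) _ rfl

theorem coeff_mul_eq_zero_of_lt {S : Type*} [CommRing S] {F F' : S⟦X⟧} {m n : ℕ}
    (hF : ∀ k, m < k → coeff k F = 0) (hF' : ∀ k, n < k → coeff k F' = 0) :
    ∀ k, m + n < k → coeff k (F * F') = 0 := by
  intro k hk
  rw [coeff_mul]
  refine Finset.sum_eq_zero fun x hx => ?_
  have hx := Finset.HasAntidiagonal.mem_antidiagonal.1 hx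
  rcases lt_or_ge m x.1 with h | h
  · rw [hF _ h, zero_mul]
  · rw [hF' x.2 (by omega), mul_zero]

theorem coeff_pow_eq_zero_of_lt {S : Type*} [CommRing S] {F : S⟦X⟧}
    (hF : ∀ k, 1 < k → coeff k F = 0) (n : ℕ) : ∀ k, n < k → coeff k (F ^ n) = 0 := by
  induction n with
  | zero =>
    intro k hk
    rw [pow_zero, coeff_one, if_neg hk.ne']
  | succ n ih =>
    rw [pow_succ]
    exact coeff_mul_eq_zero_of_lt ih hF

/-- The substitution `k(T) ↦ k(x_i T)`. -/
def substVar (i : Fin 3) : RatV⟦X⟧ →+* (MvPolynomial (Fin 3) RatV)⟦X⟧ :=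
  (rescale (MvPolynomial.X i)).comp (map MvPolynomial.C)

theorem coeff_substVar (i : Fin 3) (k : RatV⟦X⟧) (m : ℕ) :
    coeff m (substVar i k) = MvPolynomial.X i ^ m * MvPolynomial.C (coeff m k) := by
  simp [substVar, coeff_rescale]

/-- The coefficient of `x^a T^{|a|}` in a product `∏ k_i(x_i T)`. -/
theorem coeff_coeff_prod_substVar (k : Fin 3 → RatV⟦X⟧) (d : ℕ) (a : Fin 3 →₀ ℕ)
    (ha : a.degree = d) :
    MvPolynomial.coeff a (coeff d (∏ i, substVar i (k i))) = ∏ i, coeff (a i) (k i) := by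
  rw [coeff_prod, MvPolynomial.coeff_sum]
  have hl : ∀ l : Fin 3 →₀ ℕ, ∏ i, coeff (l i) (substVar i (k i)) =
      MvPolynomial.monomial l (∏ i, coeff (l i) (k i)) := by
    intro l
    simp only [coeff_substVar, Finset.prod_mul_distrib]
    rw [MvPolynomial.monomial_eq, map_prod, mul_comm, Finsupp.prod_fintype _ _ (by simp)]
  simp only [hl, MvPolynomial.coeff_monomial]
  rw [Finset.sum_ite_eq', if_pos]
  rw [Finset.mem_finsuppAntidiag]
  exact ⟨by rw [← ha, Finsupp.degree_eq_sum], Finset.subset_univ _⟩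

/-- The power series `y_i + T`. -/
def linVar (i : Fin 3) : RatV⟦X⟧ := C (ratVar i) + X

/-- The power series `(y_i + T)⁻¹`. -/
def invVar (i : Fin 3) : RatV⟦X⟧ := mk fun m => (-1) ^ m * (ratVar i)⁻¹ ^ (m + 1)

theorem linVar_mul_invVar (i : Fin 3) : linVar i * invVar i = 1 := by
  have h := ratVar_ne_zero i
  ext m
  rw [linVar, add_mul, map_add, coeff_C_mul]
  rcases m with _ | m
  · simp [invVar, h]
  · rw [coeff_succ_X_mul, invVar, coeff_mk, coeff_mk, coeff_one, if_neg (Nat.succ_ne_zero m)]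
    rw [pow_succ (ratVar i)⁻¹ (m + 1), pow_succ (-1 : RatV)]
    linear_combination (-(-1) ^ m * (ratVar i)⁻¹ ^ (m + 1)) * mul_inv_cancel₀ h

theorem taylor_X (i : Fin 3) : taylor (MvPolynomial.X i) = substVar i (linVar i) := by
  ext m : 1
  rw [taylor, MvPolynomial.aeval_X, coeff_substVar, linVar, map_add, map_add, map_add]
  rcases m with _ | _ | m
  · simp
  · simp [coeff_X]
  · simp [coeff_X]

theorem coeff_taylor_X_eq_zero (i : Fin 3) :
    ∀ k, 1 < k → coeff k (taylor (MvPolynomial.X i)) = 0 := by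
  intro k hk
  obtain ⟨k, rfl⟩ : ∃ m, k = m + 2 := ⟨k - 2, by omega⟩
  rw [taylor, MvPolynomial.aeval_X, map_add]
  simp [coeff_X]

theorem coeff_linVar_pow (i : Fin 3) (m c : ℕ) :
    coeff c (linVar i ^ m) = (m.choose c : RatV) * ratVar i ^ (m - c) := by
  have h := Polynomial.coeff_X_add_C_pow (ratVar i) m c
  rw [← Polynomial.coeff_coe, Polynomial.coe_pow, Polynomial.coe_add, Polynomial.coe_X,
    Polynomial.coe_C, add_comm] at h
  rw [linVar, h, mul_comm]

end Variation

/-! ### Evaluation on the line `e_1^{d-1} e_2 + ε e_1^{d-j} e_3^j` -/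

section Concrete

open PowerSeries

/-- The inverse of the Taylor expansion of `e_1^n e_2`. -/
theorem taylor_mul_inv (n : ℕ) :
    taylor (MvPolynomial.X 1 * MvPolynomial.X 0 ^ n) *
      (substVar 1 (invVar 1) * substVar 0 (invVar 0) ^ n) = 1 := by
  rw [map_mul, map_pow, taylor_X, taylor_X, mul_mul_mul_comm, ← mul_pow, ← map_mul, ← map_mul,
    linVar_mul_invVar, linVar_mul_invVar, map_one, map_one, one_pow, one_mul]

theorem derivative_taylor_X (i : Fin 3) :
    derivative _ (taylor (MvPolynomial.X i)) = C (MvPolynomial.X i) := by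
  rw [taylor, MvPolynomial.aeval_X, map_add, derivative_C, zero_add, Derivation.leibniz,
    derivative_C, derivative_X]
  simp

/-- The logarithmic derivative of the Taylor expansion of `e_1^n e_2` is
`x_2 / (y_2 + T x_2) + n x_1 / (y_1 + T x_1)`. -/
theorem coeff_logDeriv_taylor (n : ℕ) :
    coeff n (derivative _ (taylor (MvPolynomial.X 1 * MvPolynomial.X 0 ^ n)) *
      (substVar 1 (invVar 1) * substVar 0 (invVar 0) ^ n)) =
    MvPolynomial.X 1 ^ (n + 1) * MvPolynomial.C ((-1) ^ n * (ratVar 1)⁻¹ ^ (n + 1)) +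
      (n : MvPolynomial (Fin 3) RatV) *
        (MvPolynomial.X 0 ^ (n + 1) * MvPolynomial.C ((-1) ^ n * (ratVar 0)⁻¹ ^ (n + 1))) := by
  have h : ∀ i, taylor (MvPolynomial.X i) * substVar i (invVar i) = 1 := fun i => by
    rw [taylor_X, ← map_mul, linVar_mul_invVar, map_one]
  have h1 : derivative _ (taylor (MvPolynomial.X 1 * MvPolynomial.X 0 ^ n)) *
      (substVar 1 (invVar 1) * substVar 0 (invVar 0) ^ n) =
      C (MvPolynomial.X 1) * substVar 1 (invVar 1) +
        C (n : MvPolynomial (Fin 3) RatV) * (C (MvPolynomial.X 0) * substVar 0 (invVar 0)) := by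
    rw [map_mul, map_pow, Derivation.leibniz, derivative_taylor_X, derivative_pow,
      derivative_taylor_X, smul_eq_mul, smul_eq_mul, map_natCast]
    have e0 : (taylor (MvPolynomial.X 0) * substVar 0 (invVar 0)) ^ n = 1 := by rw [h, one_pow]
    rcases n with _ | m
    · simp
    · have e1 : (taylor (MvPolynomial.X 0) * substVar 0 (invVar 0)) ^ m = 1 := by rw [h, one_pow]
      rw [mul_pow] at e0 e1
      rw [Nat.add_sub_cancel]
      linear_combination (C (MvPolynomial.X 1) * substVar 1 (invVar 1)) * e0 +
        (((m + 1 : ℕ) : (MvPolynomial (Fin 3) RatV)⟦X⟧) * C (MvPolynomial.X 0) *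
          substVar 0 (invVar 0)) *
          (taylor (MvPolynomial.X 1) * substVar 1 (invVar 1) * e1 + h 1)
  rw [h1, map_add, coeff_C_mul, coeff_C_mul, coeff_C_mul, coeff_substVar, coeff_substVar, invVar,
    invVar, coeff_mk, coeff_mk, ← mul_assoc, ← mul_assoc (MvPolynomial.X 0), ← pow_succ',
    ← pow_succ']

theorem coeff_taylor_eq_zero_left (n : ℕ) : ∀ k, n + 1 < k →
    coeff k (taylor (MvPolynomial.X 1 * MvPolynomial.X 0 ^ n)) = 0 := by
  rw [map_mul, map_pow, add_comm]
  exact coeff_mul_eq_zero_of_lt (coeff_taylor_X_eq_zero 1)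
    (coeff_pow_eq_zero_of_lt (coeff_taylor_X_eq_zero 0) n)

theorem coeff_taylor_eq_zero_right {d j : ℕ} (hj : j ≤ d) : ∀ k, d < k →
    coeff k (taylor (MvPolynomial.X 0 ^ (d - j) * MvPolynomial.X 2 ^ j)) = 0 := by
  rw [map_mul, map_pow, map_pow]
  intro k hk
  exact coeff_mul_eq_zero_of_lt (coeff_pow_eq_zero_of_lt (coeff_taylor_X_eq_zero 0) (d - j))
    (coeff_pow_eq_zero_of_lt (coeff_taylor_X_eq_zero 2) j) k (by omega)

theorem coeff_zero_taylor_left (n : ℕ) :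
    coeff 0 (taylor (MvPolynomial.X 1 * MvPolynomial.X 0 ^ n)) =
      MvPolynomial.C (ratVar 1 * ratVar 0 ^ n) := by
  rw [coeff_zero_taylor, map_mul, map_pow]
  rfl

/-- `Q_d(e_1^{d-1} e_2) = (d-1) e_1^d ⊗ (e_1^{d-2} e_2)^d + e_2^d ⊗ (e_1^{d-1})^d`, stated after
applying `toPoly`, and with `d = n + 1`. -/
theorem toPoly_coeff_zero_brillQLine {n : ℕ} (hn : 1 ≤ n) {j : ℕ} (hj : j ≤ n + 1) :
    toPoly ((brillQLine (n + 1) (MvPolynomial.X 1 * MvPolynomial.X 0 ^ n)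
      (MvPolynomial.X 0 ^ (n + 1 - j) * MvPolynomial.X 2 ^ j)).coeff 0) =
    toPoly ((MvPolynomial.X 1 ^ (n + 1)) ⊗ₜ ((MvPolynomial.X 0 ^ n) ^ (n + 1)) +
      (n : ℂ) • ((MvPolynomial.X 0 ^ (n + 1)) ⊗ₜ
        ((MvPolynomial.X 1 * MvPolynomial.X 0 ^ (n - 1)) ^ (n + 1)))) := by
  have h0 := ratVar_ne_zero 0
  have h1 := ratVar_ne_zero 1
  rw [(toPoly_coeff_brillQLine (Nat.le_add_left 1 n) _ _ _ (taylor_mul_inv n)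
    (coeff_taylor_eq_zero_left n) (coeff_taylor_eq_zero_right hj)).1, Nat.add_sub_cancel,
    coeff_logDeriv_taylor, coeff_zero_taylor_left, map_add, map_smul, toPoly_tmul, toPoly_tmul]
  obtain ⟨m, rfl⟩ : ∃ m, n = m + 1 := ⟨n - 1, by omega⟩
  have hs : (-1 : RatV) ^ (m + 1) * (-1) ^ (m + 1) = 1 := by rw [← mul_pow]; simp
  have k1 : (-1) ^ (m + 1) * (ratVar 1 * ratVar 0 ^ (m + 1)) ^ (m + 1 + 1) *
      ((-1) ^ (m + 1) * (ratVar 1)⁻¹ ^ (m + 1 + 1)) =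
        algebraMap SymV RatV ((MvPolynomial.X 0 ^ (m + 1)) ^ (m + 1 + 1)) := by
    have e : ratVar 1 * ratVar 0 ^ (m + 1) * (ratVar 1)⁻¹ = ratVar 0 ^ (m + 1) := by field_simp
    rw [mul_mul_mul_comm, hs, one_mul, ← mul_pow, e, map_pow, map_pow]
    rfl
  have k0 : (-1) ^ (m + 1) * (ratVar 1 * ratVar 0 ^ (m + 1)) ^ (m + 1 + 1) *
      ((-1) ^ (m + 1) * (ratVar 0)⁻¹ ^ (m + 1 + 1)) =
        algebraMap SymV RatV ((MvPolynomial.X 1 * MvPolynomial.X 0 ^ m) ^ (m + 1 + 1)) := by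
    have e : ratVar 1 * ratVar 0 ^ (m + 1) * (ratVar 0)⁻¹ = ratVar 1 * ratVar 0 ^ m := by
      field_simp
      ring
    rw [mul_mul_mul_comm, hs, one_mul, ← mul_pow, e, map_pow, map_mul, map_pow]
    rfl
  rw [Nat.add_sub_cancel, ← k1, ← k0, Nat.cast_smul_eq_nsmul, nsmul_eq_mul]
  simp only [map_pow, map_mul, map_neg, map_one, MvPolynomial.aeval_X]
  ring

/-- The first-order coefficients of `Q_d(g + ε h)`, where `g = e_1^n e_2` and
`h = e_1^{d-j} e_3^j`, that are seen by the contraction with `g`. The excluded monomials `e_1^d` and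
`e_2^d` are those of the logarithmic derivative of `g`. -/
theorem coeff_toPoly_coeff_one_brillQLine {n : ℕ} {j : ℕ} (hj : j ≤ n + 1)
    (a : Fin 3 →₀ ℕ) (ha : a.degree = n + 1) (ha0 : a 0 ≠ n + 1) (ha1 : a 1 ≠ n + 1) :
    MvPolynomial.coeff a (toPoly ((brillQLine (n + 1) (MvPolynomial.X 1 * MvPolynomial.X 0 ^ n)
      (MvPolynomial.X 0 ^ (n + 1 - j) * MvPolynomial.X 2 ^ j)).coeff 1)) =
    (-1) ^ n * (n + 1) * (ratVar 1 * ratVar 0 ^ n) ^ (n + 1) *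
      (coeff (a 0) (linVar 0 ^ (n + 1 - j) * invVar 0 ^ n) * coeff (a 1) (invVar 1) *
        coeff (a 2) (linVar 2 ^ j)) := by
  rw [(toPoly_coeff_brillQLine (Nat.le_add_left 1 n) _ _ _ (taylor_mul_inv n)
    (coeff_taylor_eq_zero_left n) (coeff_taylor_eq_zero_right hj)).2, Nat.add_sub_cancel,
    coeff_logDeriv_taylor, coeff_zero_taylor_left, coeff_zero_taylor]
  have hne : ∀ i : Fin 3, a i ≠ n + 1 → ∀ c : RatV,
      MvPolynomial.coeff a (MvPolynomial.X i ^ (n + 1) * MvPolynomial.C c) = 0 := by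
    intro i hi c
    rw [mul_comm, MvPolynomial.coeff_C_mul, MvPolynomial.coeff_X_pow, if_neg, mul_zero]
    rintro rfl
    simp at hi
  have hprod : taylor (MvPolynomial.X 0 ^ (n + 1 - j) * MvPolynomial.X 2 ^ j) *
      (substVar 1 (invVar 1) * substVar 0 (invVar 0) ^ n) =
      ∏ i, substVar i (![linVar 0 ^ (n + 1 - j) * invVar 0 ^ n, invVar 1, linVar 2 ^ j] i) := by
    rw [Fin.prod_univ_three, map_mul, map_pow, map_pow, taylor_X, taylor_X]
    simp
    ring
  have hmain := coeff_coeff_prod_substVar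
    ![linVar 0 ^ (n + 1 - j) * invVar 0 ^ n, invVar 1, linVar 2 ^ j] (n + 1) a ha
  rw [← hprod, Fin.prod_univ_three] at hmain
  simp only [Matrix.cons_val] at hmain
  rw [← hmain]
  set P := coeff (n + 1) (taylor (MvPolynomial.X 0 ^ (n + 1 - j) * MvPolynomial.X 2 ^ j) *
      (substVar 1 (invVar 1) * substVar 0 (invVar 0) ^ n)) with hP
  set c := algebraMap SymV RatV (MvPolynomial.X 0 ^ (n + 1 - j) * MvPolynomial.X 2 ^ j) with hc
  set y := ratVar 1 * ratVar 0 ^ n with hy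
  set v1 := (-1) ^ n * (ratVar 1)⁻¹ ^ (n + 1) with hv1
  set v0 := (-1) ^ n * (ratVar 0)⁻¹ ^ (n + 1) with hv0
  have e : (-1 : MvPolynomial (Fin 3) RatV) ^ n * (MvPolynomial.C y ^ (n + 1) * (((n + 1 : ℕ) :
      MvPolynomial (Fin 3) RatV) * P) + ((n + 1 : ℕ) : MvPolynomial (Fin 3) RatV) *
        MvPolynomial.C y ^ n * MvPolynomial.C c * (MvPolynomial.X 1 ^ (n + 1) * MvPolynomial.C v1 +
          (n : MvPolynomial (Fin 3) RatV) * (MvPolynomial.X 0 ^ (n + 1) * MvPolynomial.C v0))) =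
      MvPolynomial.C ((-1) ^ n * (n + 1) * y ^ (n + 1)) * P +
      (MvPolynomial.C ((-1) ^ n * (n + 1) * y ^ n * c) *
        (MvPolynomial.X 1 ^ (n + 1) * MvPolynomial.C v1) +
        MvPolynomial.C ((-1) ^ n * (n + 1) * y ^ n * c * n) *
        (MvPolynomial.X 0 ^ (n + 1) * MvPolynomial.C v0)) := by
    simp only [map_mul, map_pow, map_neg, map_one, map_add, map_natCast]
    push_cast
    ring
  rw [e, MvPolynomial.coeff_add, MvPolynomial.coeff_add, MvPolynomial.coeff_C_mul,
    MvPolynomial.coeff_C_mul, MvPolynomial.coeff_C_mul, hne 0 ha0, hne 1 ha1]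
  ring

end Concrete

/-! ### The coefficients that enter the pairing -/

section Coefficients

open PowerSeries

theorem constantCoeff_linVar (i : Fin 3) : constantCoeff (linVar i) = ratVar i := by
  simp [linVar]

theorem constantCoeff_invVar (i : Fin 3) : constantCoeff (invVar i) = (ratVar i)⁻¹ := by
  rw [← coeff_zero_eq_constantCoeff_apply, invVar, coeff_mk]
  simp

theorem pow_mul_coeff_zero_linVar_mul_invVar (i : Fin 3) (m n : ℕ) :
    ratVar i ^ n * coeff 0 (linVar i ^ m * invVar i ^ n) = ratVar i ^ m := by
  rw [coeff_zero_eq_constantCoeff_apply, map_mul, map_pow, map_pow, constantCoeff_linVar,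
    constantCoeff_invVar, mul_left_comm, ← mul_pow, mul_inv_cancel₀ (ratVar_ne_zero i), one_pow,
    mul_one]

/-- The coefficient of `T` in `(y_i + T)^{m-n}` is `(m-n) y_i^{m-n-1}`. -/
theorem pow_mul_coeff_one_linVar_mul_invVar (i : Fin 3) (m : ℕ) {n : ℕ} (hn : 1 ≤ n) :
    ratVar i ^ (n + 1) * coeff 1 (linVar i ^ m * invVar i ^ n) =
      ((m : RatV) - n) * ratVar i ^ m := by
  have h := ratVar_ne_zero i
  obtain ⟨n, rfl⟩ : ∃ k, n = k + 1 := ⟨n - 1, by omega⟩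
  have h1 : coeff 1 (linVar i) = 1 := by simp [linVar]
  have h2 : coeff 1 (invVar i) = -(ratVar i)⁻¹ ^ 2 := by simp [invVar]
  have h3 : ∀ k, ratVar i ^ k * (ratVar i)⁻¹ ^ k = 1 := fun k => by
    rw [← mul_pow, mul_inv_cancel₀ h, one_pow]
  have h4 : (m : RatV) * ratVar i ^ (m - 1) * ratVar i = m * ratVar i ^ m := by
    rcases m with _ | m
    · simp
    · rw [Nat.add_sub_cancel, mul_assoc, ← pow_succ]
  rw [coeff_one_mul, coeff_one_pow, coeff_one_pow, map_pow, map_pow, constantCoeff_linVar,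
    constantCoeff_invVar, h1, h2, Nat.add_sub_cancel]
  have e : ratVar i ^ (n + 1 + 1) * (m * 1 * ratVar i ^ (m - 1) * (ratVar i)⁻¹ ^ (n + 1) +
      ((n + 1 : ℕ) : RatV) * -(ratVar i)⁻¹ ^ 2 * (ratVar i)⁻¹ ^ n * ratVar i ^ m) =
      (m * ratVar i ^ (m - 1) * ratVar i) * (ratVar i ^ (n + 1) * (ratVar i)⁻¹ ^ (n + 1)) -
        ((n + 1 : ℕ) : RatV) * ratVar i ^ m * (ratVar i ^ (n + 2) * (ratVar i)⁻¹ ^ (n + 2)) := by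
    ring
  rw [e, h3, h3, h4]
  ring

theorem pow_mul_coeff_invVar (i : Fin 3) {n t : ℕ} (ht : t ≤ n) :
    (-1) ^ n * ratVar i ^ (n + 1) * coeff (n - t) (invVar i) = (-1) ^ t * ratVar i ^ t := by
  obtain ⟨s, rfl⟩ := Nat.exists_eq_add_of_le ht
  have h3 : ∀ k, ratVar i ^ k * (ratVar i)⁻¹ ^ k = 1 := fun k => by
    rw [← mul_pow, mul_inv_cancel₀ (ratVar_ne_zero i), one_pow]
  have hs : (-1 : RatV) ^ s * (-1) ^ s = 1 := by rw [← mul_pow]; simp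
  rw [Nat.add_sub_cancel_left, invVar, coeff_mk]
  linear_combination
    ((-1) ^ t * ratVar i ^ t) * (ratVar i ^ (s + 1) * (ratVar i)⁻¹ ^ (s + 1)) * hs +
    ((-1) ^ t * ratVar i ^ t) * h3 (s + 1)

theorem algebraMap_smul_monomial (c : ℂ) (u v w : ℕ) :
    algebraMap SymV RatV (c • (MvPolynomial.X 0 ^ u * MvPolynomial.X 1 ^ v *
      MvPolynomial.X 2 ^ w)) =
        algebraMap ℂ RatV c * (ratVar 0 ^ u * ratVar 1 ^ v * ratVar 2 ^ w) := by
  rw [Algebra.smul_def, map_mul, ← IsScalarTower.algebraMap_apply, map_mul, map_mul, map_pow,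
    map_pow, map_pow]
  rfl

/-- The part of the first-order variation of `Q_d` at `e_1^n e_2` with one factor `e_1` on the
left. The factor `1 - j` is the exponent in `(y_1 + T)^{(n+1-j)-n}`. -/
theorem coeffLeft_one_brillQLine {n : ℕ} (hn : 1 ≤ n) {j t : ℕ} (hj : j ≤ n + 1) (ht : t ≤ n) :
    coeffLeft (multiIdx 1 (n - t) t) ((brillQLine (n + 1) (MvPolynomial.X 1 * MvPolynomial.X 0 ^ n)
      (MvPolynomial.X 0 ^ (n + 1 - j) * MvPolynomial.X 2 ^ j)).coeff 1) =
    (((n : ℂ) + 1) * (1 - j) * (-1) ^ t * j.choose t) • (MvPolynomial.X 0 ^ ((n + 1) * n - j) *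
      MvPolynomial.X 1 ^ t * MvPolynomial.X 2 ^ (j - t)) := by
  refine coeffLeft_eq_of_coeff_toPoly ?_
  rw [coeff_toPoly_coeff_one_brillQLine hj _ (by rw [degree_multiIdx]; omega)
    (by rw [multiIdx_zero]; omega) (by rw [multiIdx_one]; omega), algebraMap_smul_monomial,
    multiIdx_zero, multiIdx_one, multiIdx_two, coeff_linVar_pow]
  have h0 := pow_mul_coeff_one_linVar_mul_invVar 0 (n + 1 - j) hn
  have h1 := pow_mul_coeff_invVar 1 ht
  obtain ⟨m, rfl⟩ : ∃ m, n = m + 1 := ⟨n - 1, by omega⟩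
  have hexp : (m + 1 + 1) * (m + 1) - j = m * (m + 2) + (m + 1 + 1 - j) := by
    have : (m + 1 + 1) * (m + 1) = m * (m + 2) + (m + 1 + 1) := by ring
    omega
  have hcast : ((m + 1 + 1 - j : ℕ) : RatV) - (m + 1 : ℕ) = 1 - j := by
    rw [Nat.cast_sub hj]; push_cast; ring
  rw [hcast] at h0
  rw [hexp]
  simp only [map_mul, map_add, map_sub, map_one, map_pow, map_neg, map_natCast]
  push_cast at h1 ⊢
  linear_combination (((m : RatV) + 1 + 1) * (j.choose t : RatV) * ratVar 2 ^ (j - t) *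
    ratVar 0 ^ (m * (m + 2))) * (ratVar 0 ^ (m + 1 + 1) *
      coeff 1 (linVar 0 ^ (m + 1 + 1 - j) * invVar 0 ^ (m + 1)) * h1 +
        (-1) ^ t * ratVar 1 ^ t * h0)

/-- The part of the first-order variation of `Q_d` at `e_1^n e_2` with no factor `e_1` on the
left. -/
theorem coeffLeft_zero_brillQLine {n : ℕ} {j t : ℕ} (hj : j ≤ n + 1) (ht : t ≤ n) :
    coeffLeft (multiIdx 0 (n - t) (t + 1))
      ((brillQLine (n + 1) (MvPolynomial.X 1 * MvPolynomial.X 0 ^ n)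
        (MvPolynomial.X 0 ^ (n + 1 - j) * MvPolynomial.X 2 ^ j)).coeff 1) =
    (((n : ℂ) + 1) * (-1) ^ t * j.choose (t + 1)) • (MvPolynomial.X 0 ^ ((n + 1) * n + 1 - j) *
      MvPolynomial.X 1 ^ t * MvPolynomial.X 2 ^ (j - (t + 1))) := by
  refine coeffLeft_eq_of_coeff_toPoly ?_
  rw [coeff_toPoly_coeff_one_brillQLine hj _ (by rw [degree_multiIdx]; omega)
    (by rw [multiIdx_zero]; omega) (by rw [multiIdx_one]; omega), algebraMap_smul_monomial,
    multiIdx_zero, multiIdx_one, multiIdx_two, coeff_linVar_pow]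
  have h0 := pow_mul_coeff_zero_linVar_mul_invVar 0 (n + 1 - j) n
  have h1 := pow_mul_coeff_invVar 1 ht
  have hexp : (n + 1) * n + 1 - j = n * n + (n + 1 - j) := by
    have : (n + 1) * n + 1 = n * n + (n + 1) := by ring
    omega
  rw [hexp]
  simp only [map_mul, map_add, map_one, map_pow, map_neg, map_natCast]
  linear_combination (((n : RatV) + 1) * (j.choose (t + 1) : RatV) * ratVar 2 ^ (j - (t + 1)) *
    ratVar 0 ^ (n * n)) * (ratVar 0 ^ n *
      coeff 0 (linVar 0 ^ (n + 1 - j) * invVar 0 ^ n) * h1 + (-1) ^ t * ratVar 1 ^ t * h0)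

end Coefficients

/-! ### Pairing with the highest weight vector -/

theorem herm_add_left (d : ℕ) (x x' y : SymWedge ⊗[ℂ] SymV) :
    herm d (x + x') y = herm d x y + herm d x' y := by
  rw [herm, map_add, inner_add_right]
  rfl

theorem herm_smul_left (d : ℕ) (c : ℂ) (x y : SymWedge ⊗[ℂ] SymV) :
    herm d (c • x) y = c * herm d x y := by
  rw [herm, map_smul, inner_smul_right]
  rfl

theorem herm_zero_left (d : ℕ) (y : SymWedge ⊗[ℂ] SymV) : herm d 0 y = 0 := by
  rw [herm, map_zero, inner_zero_right]

theorem herm_sum_left {ι : Type*} (d : ℕ) (s : Finset ι) (x : ι → SymWedge ⊗[ℂ] SymV)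
    (y : SymWedge ⊗[ℂ] SymV) : herm d (∑ i ∈ s, x i) y = ∑ i ∈ s, herm d (x i) y := by
  simp only [herm, map_sum, inner_sum]

/-- The monomial with index `(s, t)` in the defining sum of `ṽ_j`. -/
def hwMonomial (d j s t : ℕ) : SymWedge ⊗[ℂ] SymV :=
  (wedge 0 1 ^ (d + s - j - t) * wedge 0 2 ^ t * wedge 1 2 ^ (j - s)) ⊗ₜ[ℂ]
    (MvPolynomial.X 0 ^ (d ^ 2 - d - s) * MvPolynomial.X 1 ^ t * MvPolynomial.X 2 ^ (s - t))

/-- The multi-index of `(e_1 ∧ e_2)^p (e_1 ∧ e_3)^q (e_2 ∧ e_3)^r`. -/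
def pairIdx (p q r : ℕ) : Pairs →₀ ℕ :=
  Finsupp.single ⟨(0, 1), by decide⟩ p + Finsupp.single ⟨(0, 2), by decide⟩ q +
    Finsupp.single ⟨(1, 2), by decide⟩ r

theorem univ_pairs : (Finset.univ : Finset Pairs) =
    {⟨(0, 1), by decide⟩, ⟨(0, 2), by decide⟩, ⟨(1, 2), by decide⟩} := by decide

theorem degree_pairIdx (p q r : ℕ) : (pairIdx p q r).degree = p + q + r := by
  simp [pairIdx]

theorem prod_factorial_pairIdx (p q r : ℕ) :
    ∏ i, ((pairIdx p q r i)! : ℂ) = (p ! : ℂ) * q ! * r ! := by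
  rw [univ_pairs]
  simp [pairIdx, mul_assoc]

theorem monomial_pairIdx (p q r : ℕ) : (MvPolynomial.monomial (pairIdx p q r) 1 : SymWedge) =
    wedge 0 1 ^ p * wedge 0 2 ^ q * wedge 1 2 ^ r := by
  have h : ∀ (i : Pairs) (n : ℕ), (MvPolynomial.X i ^ n : SymWedge) =
      MvPolynomial.monomial (Finsupp.single i n) 1 := fun i n => MvPolynomial.X_pow_eq_monomial
  simp [wedge, h, MvPolynomial.monomial_mul, pairIdx]

theorem monomial_multiIdx (u v w : ℕ) : (MvPolynomial.monomial (multiIdx u v w) 1 : SymV) =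
    MvPolynomial.X 0 ^ u * MvPolynomial.X 1 ^ v * MvPolynomial.X 2 ^ w := by
  rw [MvPolynomial.monomial_eq, Finsupp.prod_fintype _ _ (by simp), Fin.prod_univ_three, map_one,
    one_mul]
  rfl

theorem hwMonomial_eq_monomial (d j s t : ℕ) : hwMonomial d j s t =
    MvPolynomial.monomial (pairIdx (d + s - j - t) t (j - s)) 1 ⊗ₜ
      MvPolynomial.monomial (multiIdx (d ^ 2 - d - s) t (s - t)) 1 := by
  rw [monomial_pairIdx, monomial_multiIdx, hwMonomial]

theorem herm_hwMonomial {d j s t s' t' : ℕ} (hj : j ≤ d) (hN : d ≤ d ^ 2 - d) (hs : s ≤ j)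
    (ht : t ≤ s) (hs' : s' ≤ j) (ht' : t' ≤ s') :
    herm d (hwMonomial d j s t) (hwMonomial d j s' t') = if s = s' ∧ t = t' then
      (1 / 2 : ℂ) ^ d / ((d ! : ℂ) * ((d ^ 2 - d)! : ℂ)) *
        (((d + s - j - t)! : ℂ) * t ! * (j - s)! * ((d ^ 2 - d - s)! * t ! * (s - t)!)) else 0 := by
  rw [hwMonomial_eq_monomial, hwMonomial_eq_monomial, herm_monomial]
  · have hiff : (pairIdx (d + s - j - t) t (j - s) = pairIdx (d + s' - j - t') t' (j - s') ∧
        multiIdx (d ^ 2 - d - s) t (s - t) = multiIdx (d ^ 2 - d - s') t' (s' - t')) ↔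
        s = s' ∧ t = t' := by
      constructor
      · rintro ⟨-, h⟩
        have h1 := DFunLike.congr_fun h 1
        have h2 := DFunLike.congr_fun h 2
        simp only [multiIdx_one, multiIdx_two] at h1 h2
        omega
      · rintro ⟨rfl, rfl⟩
        exact ⟨rfl, rfl⟩
    rw [if_congr hiff rfl rfl, prod_factorial_pairIdx, Fin.prod_univ_three]
    rfl
  · rw [degree_pairIdx]; omega
  · rw [degree_pairIdx]; omega
  · rw [degree_multiIdx]; omega
  · rw [degree_multiIdx]; omega

/-- Only one of the monomials of `ṽ_j` pairs with a given one of them. -/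
theorem herm_hwMonomial_hwVector {d j s t : ℕ} (hj : j ≤ d) (hN : d ≤ d ^ 2 - d) (hs : s ≤ j)
    (ht : t ≤ s) :
    herm d (hwMonomial d j s t) (hwVector d j) = (-1 : ℂ) ^ t * j.choose s * s.choose t *
      ((1 / 2 : ℂ) ^ d / ((d ! : ℂ) * ((d ^ 2 - d)! : ℂ)) *
        (((d + s - j - t)! : ℂ) * t ! * (j - s)! * ((d ^ 2 - d - s)! * t ! * (s - t)!))) := by
  have hsum : herm d (hwMonomial d j s t) (hwVector d j) =
      ∑ s' ∈ Finset.range (j + 1), ∑ t' ∈ Finset.range (s' + 1),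
        ((-1 : ℂ) ^ t' * (j.choose s' : ℂ) * (s'.choose t' : ℂ)) *
          herm d (hwMonomial d j s t) (hwMonomial d j s' t') := by
    rw [herm, hwVector, map_sum, sum_inner]
    refine Finset.sum_congr rfl fun s' _ => ?_
    rw [map_sum, sum_inner]
    refine Finset.sum_congr rfl fun t' _ => ?_
    rw [map_smul, inner_smul_left]
    congr 1
    simp
  rw [hsum, Finset.sum_eq_single s, Finset.sum_eq_single t,
    herm_hwMonomial hj hN hs ht hs ht, if_pos ⟨rfl, rfl⟩]
  · intro t' ht' hne
    rw [Finset.mem_range, Nat.lt_succ_iff] at ht'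
    rw [herm_hwMonomial hj hN hs ht hs ht', if_neg fun h => hne h.2.symm, mul_zero]
  · intro h
    exact absurd (Finset.mem_range.2 (Nat.lt_succ_of_le ht)) h
  · intro s' hs' hne
    rw [Finset.mem_range, Nat.lt_succ_iff] at hs'
    refine Finset.sum_eq_zero fun t' ht' => ?_
    rw [Finset.mem_range, Nat.lt_succ_iff] at ht'
    rw [herm_hwMonomial hj hN hs ht hs' ht', if_neg fun h => hne h.1.symm, mul_zero]
  · intro h
    exact absurd (Finset.mem_range.2 (Nat.lt_succ_of_le hs)) h

theorem choose_mul_factorial_sq {j t : ℕ} (ht : t ≤ j) :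
    (j.choose t : ℂ) ^ 2 * ((t ! : ℂ) ^ 2 * (j - t)!) = (j ! : ℂ) ^ 2 / (j - t)! := by
  have h : (j.choose t : ℂ) * t ! * (j - t)! = j ! := by
    exact_mod_cast Nat.choose_mul_factorial_mul_factorial ht
  have h0 : ((j - t)! : ℂ) ≠ 0 := by exact_mod_cast Nat.factorial_ne_zero _
  rw [eq_div_iff h0, ← h]
  ring

/-- The contribution of the variation of `Q_d` to the pairing. The summand `t = d` of the first
sum, which occurs only for `j = d`, is not part of it. -/
theorem herm_rTensor_coeff_one {n j : ℕ} (hn : 1 ≤ n) (hj : j ≤ n + 1) :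
    herm (n + 1) (LinearMap.rTensor SymV (piDD (n + 1) (MvPolynomial.X 1 * MvPolynomial.X 0 ^ n))
      ((brillQLine (n + 1) (MvPolynomial.X 1 * MvPolynomial.X 0 ^ n)
        (MvPolynomial.X 0 ^ (n + 1 - j) * MvPolynomial.X 2 ^ j)).coeff 1)) (hwVector (n + 1) j) =
    (1 / 2 : ℂ) ^ (n + 1) / (((n + 1) ^ 2 - (n + 1))! : ℂ) *
      ((∑ t ∈ Finset.range (n + 1), if t ≤ j then (j ! : ℂ) ^ 2 * ((j : ℂ) - 1) *
          ((n + 1 - t)! : ℂ) * (((n + 1) ^ 2 - (n + 1) - j)! : ℂ) / ((j - t)! : ℂ) else 0) +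
        ∑ t ∈ Finset.range j, (j ! : ℂ) ^ 2 * ((n + 1 - t - 1)! : ℂ) *
          (((n + 1) ^ 2 - (n + 1) - j + 1)! : ℂ) / ((j - t - 1)! : ℂ)) := by
  have hN : (n + 1) ^ 2 - (n + 1) = (n + 1) * n := by
    rw [pow_two, Nat.mul_succ, Nat.add_sub_cancel]
  have hN' : n + 1 ≤ (n + 1) ^ 2 - (n + 1) := by
    rw [hN]
    exact Nat.le_mul_of_pos_right _ hn
  have hfac : ((n + 1)! : ℂ) = (n + 1) * n ! := by
    rw [Nat.factorial_succ]
    push_cast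
    rfl
  have hd0 : ((n + 1)! : ℂ) ≠ 0 := by exact_mod_cast Nat.factorial_ne_zero _
  have hN0 : ((((n + 1) ^ 2 - (n + 1))! : ℕ) : ℂ) ≠ 0 := by
    exact_mod_cast Nat.factorial_ne_zero _
  have hsq : ∀ t : ℕ, (-1 : ℂ) ^ t * (-1) ^ t = 1 := fun t => by rw [← mul_pow]; simp
  rw [rTensor_piDD_X_mul_X_pow, herm_add_left, herm_sum_left, herm_sum_left, mul_add]
  congr 1
  · rw [Finset.mul_sum]
    refine Finset.sum_congr rfl fun t ht => ?_
    rw [Finset.mem_range, Nat.lt_succ_iff] at ht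
    rw [coeffLeft_one_brillQLine hn hj ht, TensorProduct.tmul_smul, herm_smul_left, herm_smul_left]
    split_ifs with htj
    · have hm : (wedge 0 1 ^ (n + 1 - t) * wedge 0 2 ^ t) ⊗ₜ[ℂ]
          (MvPolynomial.X 0 ^ ((n + 1) * n - j) * MvPolynomial.X 1 ^ t *
            MvPolynomial.X 2 ^ (j - t) : SymV) = hwMonomial (n + 1) j j t := by
        rw [hwMonomial, hN, Nat.sub_self, pow_zero, mul_one, Nat.add_sub_cancel]
      rw [hm, herm_hwMonomial_hwVector hj hN' le_rfl htj, Nat.choose_self, Nat.sub_self,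
        Nat.factorial_zero, Nat.add_sub_cancel]
      have h := choose_mul_factorial_sq htj
      rw [mul_div_right_comm, mul_div_right_comm, mul_div_right_comm, ← h]
      field_simp
      rw [hfac]
      push_cast
      linear_combination ((n : ℂ) + 1) * n ! * (j - 1) * j.choose t ^ 2 * (n + 1 - t)! * t ! ^ 2 *
        ((n + 1) ^ 2 - (n + 1) - j)! * (j - t)! * hsq t
    · rw [Nat.choose_eq_zero_of_lt (not_le.1 htj)]
      simp
  · rw [Finset.mul_sum]
    have hext : ∀ f : ℕ → ℂ, (∀ t, t ≤ n → j ≤ t → f t = 0) →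
        ∑ t ∈ Finset.range (n + 1), f t = ∑ t ∈ Finset.range j, f t := by
      intro f hf
      symm
      refine Finset.sum_subset (Finset.range_subset_range.2 hj) fun t ht' ht => hf t ?_ ?_
      · simpa [Nat.lt_succ_iff] using ht'
      · simpa using ht
    rw [hext]
    · refine Finset.sum_congr rfl fun t ht => ?_
      rw [Finset.mem_range] at ht
      obtain ⟨i, rfl⟩ : ∃ i, j = i + 1 := ⟨j - 1, by omega⟩
      rw [coeffLeft_zero_brillQLine hj (by omega), TensorProduct.tmul_smul, herm_smul_left,
        herm_smul_left]
      have hm : (wedge 0 1 ^ (n - t) * wedge 0 2 ^ t * wedge 1 2) ⊗ₜ[ℂ]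
          (MvPolynomial.X 0 ^ ((n + 1) * n + 1 - (i + 1)) *
          MvPolynomial.X 1 ^ t * MvPolynomial.X 2 ^ (i + 1 - (t + 1)) : SymV) =
            hwMonomial (n + 1) (i + 1) i t := by
        rw [hwMonomial, hN, Nat.add_sub_cancel_left, pow_one, Nat.add_sub_add_right,
          Nat.add_sub_add_right, show n + 1 + i - (i + 1) - t = n - t by omega]
      rw [hm, herm_hwMonomial_hwVector hj hN' (Nat.le_succ i) (by omega), Nat.add_sub_cancel_left,
        show n + 1 + i - (i + 1) - t = n - t by omega, show n + 1 - t - 1 = n - t by omega,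
        show i + 1 - t - 1 = i - t by omega,
        show (n + 1) ^ 2 - (n + 1) - (i + 1) + 1 = (n + 1) ^ 2 - (n + 1) - i by omega,
        Nat.choose_succ_self_right, Nat.factorial_one]
      have h := choose_mul_factorial_sq (show t ≤ i by omega)
      have hch : ((t : ℂ) + 1) * ((i + 1).choose (t + 1) : ℂ) = ((i : ℂ) + 1) * i.choose t := by
        have := Nat.add_one_mul_choose_eq i t
        rw [mul_comm ((t : ℂ) + 1)]
        exact_mod_cast this.symm
      have hfi : ((i + 1)! : ℂ) ^ 2 / (i - t)! =
          ((i : ℂ) + 1) ^ 2 * ((i.choose t : ℂ) ^ 2 * ((t ! : ℂ) ^ 2 * (i - t)!)) := by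
        rw [h, Nat.factorial_succ]
        push_cast
        ring
      rw [mul_div_right_comm, mul_div_right_comm, hfi]
      field_simp
      rw [hfac]
      push_cast
      linear_combination ((n : ℂ) + 1) * n ! * ((i : ℂ) + 1) * i.choose t * (n - t)! * t ! ^ 2 *
        ((n + 1) ^ 2 - (n + 1) - i)! * (i - t)! *
          (((t : ℂ) + 1) * (i + 1).choose (t + 1) * hsq t + hch)
    · intro t htn htj
      rw [coeffLeft_zero_brillQLine hj htn, Nat.choose_eq_zero_of_lt (Nat.lt_succ_of_le htj)]
      simp [herm_zero_left]

/-- The contribution of the variation of the factor `f` of `f ⊗ Q_d(f)`. It contains the summand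
`t = d` of the first sum. -/
theorem herm_rTensor_coeff_zero {n j : ℕ} (hn : 1 ≤ n) (hj : j ≤ n + 1) :
    herm (n + 1) (LinearMap.rTensor SymV
        (piDD (n + 1) (MvPolynomial.X 0 ^ (n + 1 - j) * MvPolynomial.X 2 ^ j))
      ((brillQLine (n + 1) (MvPolynomial.X 1 * MvPolynomial.X 0 ^ n)
        (MvPolynomial.X 0 ^ (n + 1 - j) * MvPolynomial.X 2 ^ j)).coeff 0)) (hwVector (n + 1) j) =
    (1 / 2 : ℂ) ^ (n + 1) / (((n + 1) ^ 2 - (n + 1))! : ℂ) *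
      ((if j = n + 1 then (j ! : ℂ) ^ 2 * ((j : ℂ) - 1) * (((n + 1) ^ 2 - (n + 1) - j)! : ℂ)
          else 0) +
        (-1) ^ j * ((n + 1 - j)! : ℂ) * (j ! : ℂ) * (((n + 1) ^ 2 - (n + 1))! : ℂ)) := by
  have hN : (n + 1) ^ 2 - (n + 1) = (n + 1) * n := by
    rw [pow_two, Nat.mul_succ, Nat.add_sub_cancel]
  have hN' : n + 1 ≤ (n + 1) ^ 2 - (n + 1) := by
    rw [hN]
    exact Nat.le_mul_of_pos_right _ hn
  have hd0 : ((n + 1)! : ℂ) ≠ 0 := by exact_mod_cast Nat.factorial_ne_zero _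
  have hN0 : ((((n + 1) ^ 2 - (n + 1))! : ℕ) : ℂ) ≠ 0 := by
    exact_mod_cast Nat.factorial_ne_zero _
  have hsq : ∀ t : ℕ, (-1 : ℂ) ^ t * (-1) ^ t = 1 := fun t => by rw [← mul_pow]; simp
  have hmon : (MvPolynomial.X 0 ^ (n + 1 - j) * MvPolynomial.X 2 ^ j : SymV) =
      MvPolynomial.monomial (multiIdx (n + 1 - j) 0 j) 1 := by
    rw [monomial_multiIdx, pow_zero, mul_one]
  have hdeg : (multiIdx (n + 1 - j) 0 j).degree = n + 1 := by rw [degree_multiIdx]; omega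
  -- only the coefficients of the monomials of degree `d` matter
  have hr : ∀ r r' : SymV ⊗[ℂ] SymV, toPoly r = toPoly r' →
      LinearMap.rTensor SymV (piDD (n + 1) (MvPolynomial.monomial (multiIdx (n + 1 - j) 0 j) 1)) r =
        LinearMap.rTensor SymV
          (piDD (n + 1) (MvPolynomial.monomial (multiIdx (n + 1 - j) 0 j) 1)) r' := by
    intro r r' h
    obtain ⟨w, hw⟩ := exists_word _ hdeg
    have hS : ∀ a, a ∉ Finset.univ.finsuppAntidiag (n + 1) →
        piDD (n + 1) (MvPolynomial.monomial (multiIdx (n + 1 - j) 0 j) 1)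
          (MvPolynomial.monomial a 1) = 0 := by
      intro a ha
      rw [← hw, ← prod_X_eq_monomial]
      refine piDD_monomial_of_degree_ne _ _ _ (fun h => ha ?_) _
      rw [Finset.mem_finsuppAntidiag]
      exact ⟨by rw [← h, Finsupp.degree_eq_sum], Finset.subset_univ _⟩
    rw [rTensor_eq_sum_coeffLeft _ _ hS, rTensor_eq_sum_coeffLeft _ _ hS]
    simp only [coeffLeft_eq_of_toPoly_eq h]
  have hL := hr _ _ (hmon ▸ toPoly_coeff_zero_brillQLine hn hj)
  rw [hmon, hL, map_add, map_smul, LinearMap.rTensor_tmul, LinearMap.rTensor_tmul,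
    piDD_monomial_X_pow _ hdeg, piDD_monomial_X_pow _ hdeg, herm_add_left, herm_smul_left,
    ← TensorProduct.smul_tmul', ← TensorProduct.smul_tmul', herm_smul_left, herm_smul_left,
    Fin.prod_univ_three, Fin.prod_univ_three]
  simp only [multiIdx_zero, multiIdx_one, multiIdx_two, pow_zero, mul_one]
  have w00 : wedge 0 0 = 0 := by simp [wedge]
  have w20 : wedge 2 0 = -wedge 0 2 := by simp [wedge]
  have w21 : wedge 2 1 = -wedge 1 2 := by simp [wedge]
  have hneg : ∀ (x y : SymWedge) (q : SymV), (x * (-y) ^ j) ⊗ₜ[ℂ] q =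
      ((-1 : ℂ) ^ j) • ((x * y ^ j) ⊗ₜ[ℂ] q) := by
    intro x y q
    rw [TensorProduct.smul_tmul', neg_pow, mul_left_comm, Algebra.smul_def]
    simp
  rw [w00, w20, w21, hneg, hneg, herm_smul_left, herm_smul_left]
  have hm1 : (wedge 0 1 ^ (n + 1 - j) * wedge 1 2 ^ j) ⊗ₜ[ℂ]
      ((MvPolynomial.X 0 ^ n) ^ (n + 1) : SymV) = hwMonomial (n + 1) j 0 0 := by
    rw [hwMonomial, hN, ← pow_mul, mul_comm n]
    simp
  rw [hm1, herm_hwMonomial_hwVector hj hN' (Nat.zero_le j) le_rfl, mul_add, add_comm]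
  congr 1
  · split_ifs with h
    · subst h
      have hm2 : (0 ^ (n + 1 - (n + 1)) * wedge 0 2 ^ (n + 1)) ⊗ₜ[ℂ]
          ((MvPolynomial.X 1 * MvPolynomial.X 0 ^ (n - 1)) ^ (n + 1) : SymV) =
          hwMonomial (n + 1) (n + 1) (n + 1) (n + 1) := by
        have e : (n + 1) ^ 2 - (n + 1) - (n + 1) = (n - 1) * (n + 1) := by
          rw [hN, mul_comm (n - 1), Nat.mul_sub_one]
        rw [hwMonomial, e, mul_pow, ← pow_mul, mul_comm (MvPolynomial.X 1 ^ (n + 1))]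
        simp
      rw [hm2, herm_hwMonomial_hwVector le_rfl hN' le_rfl le_rfl]
      simp only [Nat.choose_self, Nat.sub_self, Nat.factorial_zero, Nat.add_sub_cancel]
      push_cast
      field_simp
      linear_combination (n * ((n + 1) ^ 2 - (n + 1) - (n + 1))! : ℂ) * hsq (n + 1)
    · rw [zero_pow (by omega), zero_mul, TensorProduct.zero_tmul, herm_zero_left]
      simp
  · simp
    field_simp

/-- The value of the pairing, in terms of two sums of quotients of factorials. -/
theorem herm_brillMap_hwVector {d j : ℕ} (hd : 2 ≤ d) (hj : j ≤ d) :
    herm d (brillMap d (testVector d j (one_le_two.trans hd) hj)) (hwVector d j) =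
      (1 / 2 : ℂ) ^ d / (((d : ℂ) + 1) * ((d ^ 2 - d)! : ℂ)) *
        ((∑ t ∈ Finset.range (j + 1),
            (j ! : ℂ) ^ 2 * ((j : ℂ) - 1) * ((d - t)! : ℂ) * ((d ^ 2 - d - j)! : ℂ) /
              ((j - t)! : ℂ)) +
          (∑ t ∈ Finset.range j,
            (j ! : ℂ) ^ 2 * ((d - t - 1)! : ℂ) * ((d ^ 2 - d - j + 1)! : ℂ) /
              ((j - t - 1)! : ℂ)) +
          (-1) ^ j * ((d - j)! : ℂ) * (j ! : ℂ) * ((d ^ 2 - d)! : ℂ)) := by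
  obtain ⟨n, rfl⟩ : ∃ n, d = n + 1 := ⟨d - 1, by omega⟩
  have hn : 1 ≤ n := by omega
  have hg : (MvPolynomial.monomial (monoIdx (n + 1) 1 (one_le_two.trans hd) 1).1 1 : SymV) =
      MvPolynomial.X 1 * MvPolynomial.X 0 ^ n := by
    change MvPolynomial.monomial (Finsupp.single 0 n + Finsupp.single 1 1) 1 = _
    rw [MvPolynomial.X_pow_eq_monomial, MvPolynomial.X, MvPolynomial.monomial_mul, mul_one,
      add_comm]
  have hh : (MvPolynomial.monomial (monoIdx (n + 1) j hj 2).1 1 : SymV) =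
      MvPolynomial.X 0 ^ (n + 1 - j) * MvPolynomial.X 2 ^ j := by
    rw [monoIdx, MvPolynomial.X_pow_eq_monomial, MvPolynomial.X_pow_eq_monomial,
      MvPolynomial.monomial_mul, mul_one]
  rw [brillMap_testVector, hg, hh, herm_smul_left, brillPolyLine, herm_add_left,
    herm_rTensor_coeff_one hn hj, herm_rTensor_coeff_zero hn hj]
  -- the summand `t = d` of the first sum, present for `j = d`, comes from the second contribution
  have hsum : ∀ f : ℕ → ℂ, (∑ t ∈ Finset.range (n + 1), if t ≤ j then f t else 0) +
      (if j = n + 1 then f (n + 1) else 0) = ∑ t ∈ Finset.range (j + 1), f t := by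
    intro f
    rcases hj.eq_or_lt with rfl | h
    · rw [if_pos rfl, Finset.sum_range_succ _ (n + 1)]
      congr 1
      exact Finset.sum_congr rfl fun t ht => if_pos (Finset.mem_range.1 ht).le
    · rw [if_neg h.ne, add_zero, ← Finset.sum_filter]
      congr 1
      ext t
      simp only [Finset.mem_filter, Finset.mem_range]
      omega
  rw [← hsum]
  have hlast : (if j = n + 1 then (j ! : ℂ) ^ 2 * ((j : ℂ) - 1) *
        (((n + 1) ^ 2 - (n + 1) - j)! : ℂ) else 0) =
      if j = n + 1 then (j ! : ℂ) ^ 2 * ((j : ℂ) - 1) * ((n + 1 - (n + 1))! : ℂ) *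
        (((n + 1) ^ 2 - (n + 1) - j)! : ℂ) / ((j - (n + 1))! : ℂ) else 0 := by
    split_ifs with h
    · subst h
      simp
    · rfl
  rw [hlast, div_mul_eq_div_mul_one_div]
  push_cast
  ring

/-! ### Vanishing of the pairing -/

/-- The hockey-stick identity `∑_t C(m+j-t, m) = C(m+j+1, m+1)`, times `m!`. -/
theorem sum_factorial_div_factorial (m j : ℕ) :
    ∑ t ∈ Finset.range (j + 1), ((m + j - t)! : ℂ) / ((j - t)! : ℂ) =
      (m ! : ℂ) * ((m + j + 1).choose (m + 1) : ℂ) := by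
  rw [← Finset.sum_range_reflect, add_comm m j, ← Nat.sum_range_add_choose, Nat.cast_sum,
    Finset.mul_sum]
  refine Finset.sum_congr rfl fun i hi => ?_
  have hi' : i ≤ j := Nat.lt_succ_iff.1 (Finset.mem_range.1 hi)
  have h1 : j + m - (j + 1 - 1 - i) = i + m := by omega
  have h2 : j - (j + 1 - 1 - i) = i := by omega
  rw [h1, h2, div_eq_iff (by exact_mod_cast i.factorial_ne_zero)]
  have h := Nat.choose_mul_factorial_mul_factorial (Nat.le_add_left m i)
  rw [Nat.add_sub_cancel] at h
  exact_mod_cast (by rw [← h]; ring)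

/-- Each factor `d² - d - i` is at least `(d-1)(d-i)`. -/
theorem pow_mul_descFactorial_le {d : ℕ} (hd : 2 ≤ d) (i : ℕ) :
    (d - 1) ^ i * d.descFactorial i ≤ (d ^ 2 - d).descFactorial i := by
  induction i with
  | zero => simp
  | succ i ih =>
    rw [Nat.descFactorial_succ, Nat.descFactorial_succ, pow_succ]
    have h : (d - 1) * (d - i) ≤ d ^ 2 - d - i := by
      obtain ⟨n, rfl⟩ : ∃ n, d = n + 2 := ⟨d - 2, by omega⟩
      rcases le_total (n + 2) i with h | h
      · simp [Nat.sub_eq_zero_of_le h]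
      · obtain ⟨k, hk⟩ := Nat.exists_eq_add_of_le h
        have e : (n + 2) ^ 2 = (n + 1) * k + (n + 1) * i + (n + 2) := by
          rw [← mul_add, add_comm k, ← hk]
          ring
        have e1 : n + 2 - i = k := by omega
        have e2 : n + 2 - 1 = n + 1 := by omega
        rw [e1, e2, e]
        have : i ≤ (n + 1) * i := Nat.le_mul_of_pos_left _ (by omega)
        omega
    calc (d - 1) ^ i * (d - 1) * ((d - i) * d.descFactorial i)
        = ((d - 1) * (d - i)) * ((d - 1) ^ i * d.descFactorial i) := by ring
      _ ≤ _ := Nat.mul_le_mul h ih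

theorem two_mul_add_one_lt_three_pow {i : ℕ} (hi : 2 ≤ i) : 2 * i + 1 < 3 ^ i := by
  induction i, hi using Nat.le_induction with
  | base => norm_num
  | succ i _ ih => rw [pow_succ]; omega

/-- For odd `j = i + 1 ≥ 3` and `d ≥ 4` the negative summand of the pairing dominates. -/
theorem descFactorial_estimate {d i : ℕ} (hd : 4 ≤ d) (hi : 2 ≤ i) (hid : i < d) :
    i * (d + 1) * d.descFactorial i + (i + 1) * (d ^ 2 - d - i) * d.descFactorial i <
      (d ^ 2 - d).descFactorial (i + 1) := by
  have hN : d + 1 ≤ d ^ 2 - d - i := by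
    have : 4 * d ≤ d ^ 2 := by rw [sq]; exact Nat.mul_le_mul_right d hd
    omega
  have hD : 0 < d.descFactorial i := Nat.descFactorial_pos.2 hid.le
  have h3 : 2 * i + 1 < (d - 1) ^ i :=
    (two_mul_add_one_lt_three_pow hi).trans_le (Nat.pow_le_pow_left (by omega) i)
  calc i * (d + 1) * d.descFactorial i + (i + 1) * (d ^ 2 - d - i) * d.descFactorial i
      ≤ i * (d ^ 2 - d - i) * d.descFactorial i +
          (i + 1) * (d ^ 2 - d - i) * d.descFactorial i := by gcongr
    _ = (d ^ 2 - d - i) * ((2 * i + 1) * d.descFactorial i) := by ring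
    _ < (d ^ 2 - d - i) * ((d - 1) ^ i * d.descFactorial i) := by
        have : 0 < d ^ 2 - d - i := by omega
        gcongr
    _ ≤ (d ^ 2 - d - i) * (d ^ 2 - d).descFactorial i := by
        gcongr
        exact pow_mul_descFactorial_le (by omega) i
    _ = _ := (Nat.descFactorial_succ _ _).symm

/-- For `j = i + 1` the three summands of the pairing have the common factor
`(d-j)! j! (d²-d-j)!`. -/
theorem pairing_summands_eq {d i : ℕ} (hd : 2 ≤ d) (hi : i + 1 ≤ d) :
    (∑ t ∈ Finset.range (i + 1 + 1),
        ((i + 1)! : ℂ) ^ 2 * (((i + 1 : ℕ) : ℂ) - 1) * ((d - t)! : ℂ) *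
          ((d ^ 2 - d - (i + 1))! : ℂ) / ((i + 1 - t)! : ℂ)) +
      (∑ t ∈ Finset.range (i + 1),
        ((i + 1)! : ℂ) ^ 2 * ((d - t - 1)! : ℂ) * ((d ^ 2 - d - (i + 1) + 1)! : ℂ) /
          ((i + 1 - t - 1)! : ℂ)) +
      (-1) ^ (i + 1) * ((d - (i + 1))! : ℂ) * ((i + 1)! : ℂ) * ((d ^ 2 - d)! : ℂ) =
    ((d - (i + 1))! : ℂ) * ((i + 1)! : ℂ) * ((d ^ 2 - d - (i + 1))! : ℂ) *
      (((i * (d + 1) * d.descFactorial i + (i + 1) * (d ^ 2 - d - i) * d.descFactorial i : ℕ) : ℂ) +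
        (-1) ^ (i + 1) * ((d ^ 2 - d).descFactorial (i + 1) : ℂ)) := by
  obtain ⟨m, rfl⟩ : ∃ m, d = m + (i + 1) := ⟨d - (i + 1), by omega⟩
  set d := m + (i + 1) with hdd
  have hN : d ≤ d ^ 2 - d := by
    have : 2 * d ≤ d ^ 2 := by rw [sq]; exact Nat.mul_le_mul_right d hd
    omega
  have h1 : ∑ t ∈ Finset.range (i + 1 + 1),
      ((i + 1)! : ℂ) ^ 2 * (((i + 1 : ℕ) : ℂ) - 1) * ((d - t)! : ℂ) *
        ((d ^ 2 - d - (i + 1))! : ℂ) / ((i + 1 - t)! : ℂ) =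
      ((i + 1)! : ℂ) ^ 2 * i * ((d ^ 2 - d - (i + 1))! : ℂ) *
        ((m ! : ℂ) * ((d + 1).choose (m + 1) : ℂ)) := by
    rw [hdd, ← sum_factorial_div_factorial, Finset.mul_sum]
    refine Finset.sum_congr rfl fun t _ => ?_
    push_cast
    ring
  have h2 : ∑ t ∈ Finset.range (i + 1),
      ((i + 1)! : ℂ) ^ 2 * ((d - t - 1)! : ℂ) * ((d ^ 2 - d - (i + 1) + 1)! : ℂ) /
        ((i + 1 - t - 1)! : ℂ) =
      ((i + 1)! : ℂ) ^ 2 * ((d ^ 2 - d - (i + 1) + 1)! : ℂ) *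
        ((m ! : ℂ) * (d.choose (m + 1) : ℂ)) := by
    rw [show d = m + i + 1 from hdd, ← sum_factorial_div_factorial, Finset.mul_sum]
    refine Finset.sum_congr rfl fun t ht => ?_
    rw [show m + i + 1 - t - 1 = m + i - t by omega, show i + 1 - t - 1 = i - t by omega]
    ring
  have c1 : (i + 1)! * (d + 1).choose (m + 1) = (d + 1) * d.descFactorial i := by
    rw [← Nat.succ_descFactorial_succ, Nat.descFactorial_eq_factorial_mul_choose,
      ← Nat.choose_symm_of_eq_add (show d + 1 = m + 1 + (i + 1) by omega)]
  have c2 : (i + 1)! * d.choose (m + 1) = (i + 1) * d.descFactorial i := by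
    rw [Nat.factorial_succ, Nat.descFactorial_eq_factorial_mul_choose,
      ← Nat.choose_symm_of_eq_add (show d = m + 1 + i by omega), mul_assoc]
  have c3 : (d ^ 2 - d - (i + 1))! * (d ^ 2 - d).descFactorial (i + 1) = (d ^ 2 - d)! :=
    Nat.factorial_mul_descFactorial (by omega)
  have c4 : (d ^ 2 - d - (i + 1) + 1)! = (d ^ 2 - d - i) * (d ^ 2 - d - (i + 1))! := by
    rw [Nat.factorial_succ]
    congr 1
    omega
  have c1' := congrArg (Nat.cast (R := ℂ)) c1
  have c2' := congrArg (Nat.cast (R := ℂ)) c2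
  rw [h1, h2, c4, ← c3, show d - (i + 1) = m by omega]
  simp only [Nat.cast_mul, Nat.cast_add, Nat.cast_one] at c1' c2' ⊢
  linear_combination ((i + 1)! * i * (d ^ 2 - d - (i + 1))! * m ! : ℂ) * c1' +
    ((i + 1)! * (d ^ 2 - d - i : ℕ) * (d ^ 2 - d - (i + 1))! * m ! : ℂ) * c2'

/-- The bracket in the formula for the pairing vanishes exactly in the stated cases. -/
theorem pairing_eq_zero_iff {d j : ℕ} (hd : 2 ≤ d) (hj : j ≤ d) :
    (∑ t ∈ Finset.range (j + 1),
        (j ! : ℂ) ^ 2 * ((j : ℂ) - 1) * ((d - t)! : ℂ) * ((d ^ 2 - d - j)! : ℂ) /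
          ((j - t)! : ℂ)) +
      (∑ t ∈ Finset.range j,
        (j ! : ℂ) ^ 2 * ((d - t - 1)! : ℂ) * ((d ^ 2 - d - j + 1)! : ℂ) /
          ((j - t - 1)! : ℂ)) +
      (-1) ^ j * ((d - j)! : ℂ) * (j ! : ℂ) * ((d ^ 2 - d)! : ℂ) = 0 ↔
    j = 0 ∨ j = 1 ∨ (d = 3 ∧ j = 3) := by
  obtain rfl | ⟨i, rfl⟩ : j = 0 ∨ ∃ i, j = i + 1 := by
    rcases j with _ | i
    · exact Or.inl rfl
    · exact Or.inr ⟨i, rfl⟩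
  · simp
  have hfac : ∀ k : ℕ, (k ! : ℂ) ≠ 0 := fun k => by exact_mod_cast k.factorial_ne_zero
  rw [pairing_summands_eq hd hj, mul_eq_zero,
    or_iff_right (mul_ne_zero (mul_ne_zero (hfac _) (hfac _)) (hfac _))]
  have hN : d ≤ d ^ 2 - d := by
    have : 2 * d ≤ d ^ 2 := by rw [sq]; exact Nat.mul_le_mul_right d hd
    omega
  have hD : 0 < (i + 1) * (d ^ 2 - d - i) * d.descFactorial i :=
    Nat.mul_pos (Nat.mul_pos i.succ_pos (by omega)) (Nat.descFactorial_pos.2 (by omega))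
  rcases Nat.even_or_odd (i + 1) with he | ho
  · rw [he.neg_one_pow, one_mul, ← Nat.cast_add, Nat.cast_eq_zero]
    have : ¬ (i + 1 = 1) := by rintro h; simp [h] at he
    have : ¬ (i + 1 = 3) := by rintro h; simp [h] at he; exact absurd he (by decide)
    omega
  · rw [ho.neg_one_pow, neg_one_mul, ← sub_eq_add_neg, sub_eq_zero, Nat.cast_inj]
    have h2 : i ≠ 1 := by rintro rfl; exact absurd ho (by decide)
    rcases Nat.eq_zero_or_pos i with rfl | hpos
    · simp
    have hi : 2 ≤ i := by omega
    rcases le_or_gt 4 d with h4 | h4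
    · have := descFactorial_estimate h4 hi hj
      omega
    · obtain rfl : d = 3 := by omega
      obtain rfl : i = 2 := by omega
      simp [Nat.descFactorial]

end BrillMap

end

theorem mainTheorem3 (d j : ℕ) (hd : 2 ≤ d) (hj : j ≤ d) :
    BrillMap.IsHighestWeightVector d ![d ^ 2 - j, d, j] (BrillMap.hwVector d j) ∧
    BrillMap.herm d
        (BrillMap.brillMap d (BrillMap.testVector d j (one_le_two.trans hd) hj))
        (BrillMap.hwVector d j) =
      (1 / 2 : ℂ) ^ d / (((d : ℂ) + 1) * ((d ^ 2 - d)! : ℂ)) *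
        ((∑ t ∈ Finset.range (j + 1),
            (j ! : ℂ) ^ 2 * ((j : ℂ) - 1) * ((d - t)! : ℂ) * ((d ^ 2 - d - j)! : ℂ) /
              ((j - t)! : ℂ)) +
          (∑ t ∈ Finset.range j,
            (j ! : ℂ) ^ 2 * ((d - t - 1)! : ℂ) * ((d ^ 2 - d - j + 1)! : ℂ) /
              ((j - t - 1)! : ℂ)) +
          (-1) ^ j * ((d - j)! : ℂ) * (j ! : ℂ) * ((d ^ 2 - d)! : ℂ)) ∧
    (BrillMap.herm d
        (BrillMap.brillMap d (BrillMap.testVector d j (one_le_two.trans hd) hj))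
        (BrillMap.hwVector d j) = 0 ↔
      j = 0 ∨ j = 1 ∨ (d = 3 ∧ j = 3)) := by
  refine ⟨BrillMap.isHighestWeightVector_hwVector hd hj, BrillMap.herm_brillMap_hwVector hd hj, ?_⟩
  have hd1 : (d : ℂ) + 1 ≠ 0 := by exact_mod_cast d.succ_ne_zero
  have hN : ((d ^ 2 - d)! : ℂ) ≠ 0 := by exact_mod_cast Nat.factorial_ne_zero _
  rw [BrillMap.herm_brillMap_hwVector hd hj, mul_eq_zero,
    or_iff_right (div_ne_zero (by simp) (mul_ne_zero hd1 hN))]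
  exact BrillMap.pairing_eq_zero_iff hd hj
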